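/- Let $\lambda$ be the security parameter. "Polynomial" and "negligible" are meant in $\lambda$. Efficient quantum (QPT) algorithms are modelled as polynomial-size, not necessarily uniform, families of quantum circuits over unitary gates on at most three qubits, with ancillas. Let $d=2^{n}$ with $n=n(\lambda)$ polynomially bounded and $2^{-n(\lambda)}$ negligible. * A finite family $\{U_k\}_{k\in\mathcal K}\subseteq U(d)$ (depending on $\lambda$) is a *pseudorandom unitary* (PRU) family if some polynomial-size circuits map an encoding of $k$ and a state $|\psi\rangle$ to $U_k|\psi\rangle$, and for every QPT oracle algorithm $\mathcal D$ (which then makes polynomially many queries), $\big|\Pr_{k\leftarrow\mathcal K}[\mathcal D^{U_k}=1]-\Pr_{V\leftarrow\mathrm{Haar}}[\mathcal D^{V}=1]\big|$ is negligible. * A finite family $\{|\phi_{k'}\rangle\}_{k'\in\mathcal K'}$ of unit vectors of $\mathbb C^d$ is a *pseudorandom state* (PRS) family if some polynomial-size circuits map an encoding of $k'$ to $|\phi_{k'}\rangle$, and for every polynomially bounded $m(\lambda)$ and every QPT $\mathcal D$, $\big|\Pr_{k'\leftarrow\mathcal K'}[\mathcal D(|\phi_{k'}\rangle^{\otimes m})=1]-\Pr_{\psi\leftarrow\mathrm{Haar}}[\mathcal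 D(|\psi\rangle^{\otimes m})=1]\big|$ is negligible. *Efficient high-resource-verifier protocol, against an adversary.* Let $N=N(\lambda)$ and $M=M(\lambda)$ be polynomially bounded. The verifier draws $k\leftarrow\mathcal K$ uniformly and $N$ different keys $k'_1,\dots,k'_N\in\mathcal K'$ uniformly, and stores $M$ copies of each response $|r_i\rangle=U_k|\phi_{k'_i}\rangle$ ($N$ CRPs with $M$ copies each). In the learning phase a QPT adversary queries $U_k$ as an oracle. Then, without further queries, it receives challenges and returns one $d$-dimensional response register for each challenge; all challenges may be handed to it together and the responses may be entangled. * *SWAP verification:* each challenge $|\phi_{k'_i}\rangle$ is sent $M$ times, and each of the $NM$ responses is compared with one of the $M$ stored copies of $|r_i\rangle$ by a SWAP test. * *GSWAP verification:* each challenge is sent once, and the response is compared with the $M$ stored copies of $|r_i\rangle$ by one generalised SWAP test (a cyclic shift of the $M+1$ registers is applied, controlled by a uniform superposition over $\mathbb Z_{M+1}$, and the test accepts if the control is found in that superposition again; it accepts a single state $\rho$ against $M$ copies of $|\psi\rangle$ with probability $\frac1{M+1}+\frac M{M+1}\langle\psi|\rho|\psi\rangle$). The verifier accepts if and only if all tests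 accept. **Theorem.** Let $\{U_k\}$ be a PRU family and $\{|\phi_{k'}\rangle\}$ a PRS family. Then every QPT adversary passes the verification with probability at most $$\frac1{2^{NM}}+\mathrm{negl}(\lambda)\quad\text{(SWAP)},\qquad \frac1{(M+1)^{N}}+\mathrm{negl}(\lambda)\quad\text{(GSWAP)}.$$ In particular, if $2^{NM}$, respectively $(M+1)^N$, is polynomially bounded in $\lambda$ (for example, if $N$ and $M$ are constants), the probability is at most $2\cdot 2^{-NM}$, respectively $2\,(M+1)^{-N}$, for all sufficiently large $\lambda$; that is, it is $O(2^{-NM})$, respectively $O((M+1)^{-N})$, with a constant that does not depend on $N$, $M$ or the adversary. -/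

import Mathlib

namespace QIdent

open MeasureTheory Filter

/-! ## Asymptotics in the security parameter -/

/-- `f` is bounded by a polynomial in the security parameter. -/
def PolyBounded (f : ℕ → ℕ) : Prop :=
  ∃ p : Polynomial ℕ, ∀ s, f s ≤ p.eval s

/-- `f` is negligible in the security parameter: `s ^ c * f s → 0` for every `c`. -/
def Negligible (f : ℕ → ℝ) : Prop :=
  Asymptotics.SuperpolynomialDecay atTop (fun s : ℕ => (s : ℝ)) f

/-- Average of `f k` over a uniformly random `k`. -/
noncomputable def uniformAvg {K : Type*} [Fintype K] (f : K → ℝ) : ℝ :=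
  (∑ k, f k) / Fintype.card K

/-! ## Qubit registers -/

/-- Vectors of the Hilbert space of a set `ι` of qubits, as amplitudes in the computational
basis. -/
abbrev QVec (ι : Type*) := (ι → Bool) → ℂ

/-- Unitary operators on a set `ι` of qubits. -/
abbrev QUnitary (ι : Type*) [Fintype ι] [DecidableEq ι] := Matrix.unitaryGroup (ι → Bool) ℂ

section Registers

variable {ι κ T : Type*} [Fintype ι] [DecidableEq ι] [Fintype κ] [DecidableEq κ] [Fintype T]

/-- Squared Euclidean norm. -/
noncomputable def normSq (ψ : QVec ι) : ℝ := ∑ x, ‖ψ x‖ ^ 2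

/-- The basis state `|b⟩`. -/
def basisState (b : ι → Bool) : QVec ι := fun x => if x = b then 1 else 0

/-- The state `|0…0⟩`. -/
def zeroState (ι : Type*) [Fintype ι] [DecidableEq ι] : QVec ι := basisState fun _ => false

/-- `φ ⊗ χ`. -/
def tensor (φ : QVec ι) (χ : QVec κ) : QVec (ι ⊕ κ) :=
  fun x => φ (x ∘ Sum.inl) * χ (x ∘ Sum.inr)

/-- `⨂ t, φ t`. -/
def tensorFamily (φ : T → QVec ι) : QVec (T × ι) :=
  fun x => ∏ t, φ t fun i => x (t, i)

/-- `U φ`. -/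
noncomputable def applyU (U : QUnitary ι) (φ : QVec ι) : QVec ι := (U : Matrix _ _ ℂ).mulVec φ

/-- The operator `G` applied to the qubits `e` (in that order) of a larger register.
`Function.extend e y x` is the bit string `x` with the bits at the positions `e` replaced by
`y`. -/
noncomputable def applyOn (e : κ ↪ ι) (G : Matrix (κ → Bool) (κ → Bool) ℂ) (ψ : QVec ι) : QVec ι :=
  fun x => ∑ y, G (x ∘ e) y * ψ (Function.extend e y x)

/-- Probability that measuring the qubit `out` in the computational basis gives `1`. -/
noncomputable def prOne (out : ι) (ψ : QVec ι) : ℝ :=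
  ∑ x, if x out = true then ‖ψ x‖ ^ 2 else 0

end Registers

/-! ## Haar measure -/

/-- The unitary group is compact. -/
theorem isCompact_unitaryGroup (m : Type*) [Fintype m] [DecidableEq m] :
    IsCompact (Matrix.unitaryGroup m ℂ : Set (Matrix m m ℂ)) := by
  have hK : IsCompact (Set.univ.pi fun _ : m => Set.univ.pi fun _ : m =>
      Metric.closedBall (0 : ℂ) 1) :=
    isCompact_univ_pi fun _ => isCompact_univ_pi fun _ => isCompact_closedBall _ _
  refine hK.of_isClosed_subset ?_ ?_
  · have h : (Matrix.unitaryGroup m ℂ : Set (Matrix m m ℂ)) =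
        {A | A * star A = 1} := by
      ext A
      exact Matrix.mem_unitaryGroup_iff
    rw [h]
    exact isClosed_eq (by fun_prop) continuous_const
  · intro A hA i _ j _
    simpa using entry_norm_bound_of_unitary hA i j

instance unitaryGroupCompactSpace (m : Type*) [Fintype m] [DecidableEq m] :
    CompactSpace (Matrix.unitaryGroup m ℂ) :=
  isCompact_iff_compactSpace.mp (isCompact_unitaryGroup m)

noncomputable instance unitaryGroupMeasurableSpace (m : Type*) [Fintype m] [DecidableEq m] :
    MeasurableSpace (Matrix.unitaryGroup m ℂ) := borel _

instance unitaryGroupBorelSpace (m : Type*) [Fintype m] [DecidableEq m] :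
    BorelSpace (Matrix.unitaryGroup m ℂ) := ⟨rfl⟩

/-- The Haar probability measure on the unitary group of `n` qubits. -/
noncomputable def haarUnitary (n : ℕ) : Measure (QUnitary (Fin n)) :=
  Measure.haarMeasure ⊤

/-- Expectation of `f ψ` over a Haar random `n`-qubit state `ψ`, obtained by applying a Haar
random unitary to `|0…0⟩`. -/
noncomputable def haarStateAvg (n : ℕ) (f : QVec (Fin n) → ℝ) : ℝ :=
  ∫ U, f (applyU U (zeroState (Fin n))) ∂(haarUnitary n)

/-! ## Quantum circuits -/

/-- An elementary gate: an arbitrary unitary on at most three of the qubits. -/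
structure Gate (ι : Type*) where
  arity : ℕ
  arity_le : arity ≤ 3
  wires : Fin arity ↪ ι
  mat : QUnitary (Fin arity)

/-- Action of a gate on state vectors. -/
noncomputable def Gate.apply {ι : Type*} (g : Gate ι) (ψ : QVec ι) : QVec ι :=
  applyOn g.wires (g.mat : Matrix _ _ ℂ) ψ

/-- A quantum circuit; the first gate of the list is applied first. -/
abbrev Circuit (ι : Type*) := List (Gate ι)

/-- Output state of a circuit. -/
noncomputable def Circuit.run {ι : Type*} (C : Circuit ι) (ψ : QVec ι) : QVec ι :=
  C.foldl (fun v g => g.apply v) ψ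

/-- A step of a circuit with oracle: a gate, or a query of the `n`-qubit oracle unitary on the
qubits `e`. -/
inductive OracleStep (n : ℕ) (ι : Type*) where
  | gate (g : Gate ι) : OracleStep n ι
  | query (e : Fin n ↪ ι) : OracleStep n ι

/-- Action of a step when the oracle is `U`. -/
noncomputable def OracleStep.apply {n : ℕ} {ι : Type*} (U : QUnitary (Fin n)) (st : OracleStep n ι)
    (ψ : QVec ι) : QVec ι :=
  match st with
  | .gate g => g.apply ψ
  | .query e => applyOn e (U : Matrix _ _ ℂ) ψ

/-- A quantum circuit with oracle. -/
abbrev OracleCircuit (n : ℕ) (ι : Type*) := List (OracleStep n ι)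

/-- Output state of a circuit with oracle `U`. -/
noncomputable def OracleCircuit.run {n : ℕ} {ι : Type*} (C : OracleCircuit n ι) (U : QUnitary (Fin n))
    (ψ : QVec ι) : QVec ι :=
  C.foldl (fun v st => st.apply U v) ψ

/-! ## Pseudorandom unitaries -/

/-- A distinguisher with oracle access to an `n`-qubit unitary. -/
structure UnitaryDistinguisher (n : ℕ) where
  work : ℕ
  circ : OracleCircuit n (Fin work)
  out : Fin work

namespace UnitaryDistinguisher

variable {n : ℕ}

/-- Number of qubits, gates and queries. -/
def size (D : UnitaryDistinguisher n) : ℕ := D.work + D.circ.length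

/-- Probability of the output `1` when the oracle is `U`. -/
noncomputable def prob (D : UnitaryDistinguisher n) (U : QUnitary (Fin n)) : ℝ :=
  prOne D.out (D.circ.run U (zeroState (Fin D.work)))

end UnitaryDistinguisher

/-- The unitaries `U s k` on `n s` qubits, `k : K s`, form a pseudorandom unitary family. -/
structure IsPRU (n : ℕ → ℕ) {K : ℕ → Type*} [∀ s, Fintype (K s)]
    (U : ∀ s, K s → QUnitary (Fin (n s))) : Prop where
  /-- Polynomial-size circuits compute `U s k` on every state, given an encoding of `k` and
  ancillas; the final content of the other qubits is discarded. -/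
  efficient : ∃ (b a : ℕ → ℕ) (enc : ∀ s, K s → Fin (b s) → Bool)
    (C : ∀ s, Circuit ((Fin (b s) ⊕ Fin (a s)) ⊕ Fin (n s))),
    PolyBounded (fun s => b s + a s + (C s).length) ∧
    ∀ s k, ∃ g : QVec (Fin (b s) ⊕ Fin (a s)), ∀ ψ : QVec (Fin (n s)),
      (C s).run (tensor (tensor (basisState (enc s k)) (zeroState _)) ψ) =
        tensor g (applyU (U s k) ψ)
  /-- No polynomial-size oracle circuit distinguishes `U s k` for random `k` from a Haar random
  unitary. -/
  pseudorandom : ∀ D : ∀ s, UnitaryDistinguisher (n s),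
    PolyBounded (fun s => (D s).size) →
    Negligible fun s => |uniformAvg (fun k => (D s).prob (U s k)) -
      ∫ V, (D s).prob V ∂(haarUnitary (n s))|

/-! ## Pseudorandom states -/

/-- A distinguisher that receives `m` copies of an `n`-qubit state. -/
structure StateDistinguisher (n m : ℕ) where
  work : ℕ
  circ : Circuit (Fin work ⊕ (Fin m × Fin n))
  out : Fin work ⊕ (Fin m × Fin n)

namespace StateDistinguisher

variable {n m : ℕ}

/-- Number of work qubits and gates. -/
def size (D : StateDistinguisher n m) : ℕ := D.work + D.circ.length

/-- Probability of the output `1` on `m` copies of `φ`. -/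
noncomputable def prob (D : StateDistinguisher n m) (φ : QVec (Fin n)) : ℝ :=
  prOne D.out (D.circ.run (tensor (zeroState (Fin D.work)) (tensorFamily fun _ : Fin m => φ)))

end StateDistinguisher

/-- The states `φ s k` of `n s` qubits, `k : K s`, form a pseudorandom state family. -/
structure IsPRS (n : ℕ → ℕ) {K : ℕ → Type*} [∀ s, Fintype (K s)]
    (φ : ∀ s, K s → QVec (Fin (n s))) : Prop where
  unit : ∀ s k, normSq (φ s k) = 1
  /-- Polynomial-size circuits generate `φ s k`, given an encoding of `k` and ancillas; the
  final content of the other qubits is discarded. -/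
  efficient : ∃ (b a : ℕ → ℕ) (enc : ∀ s, K s → Fin (b s) → Bool)
    (C : ∀ s, Circuit ((Fin (b s) ⊕ Fin (a s)) ⊕ Fin (n s))),
    PolyBounded (fun s => b s + a s + (C s).length) ∧
    ∀ s k, ∃ g : QVec (Fin (b s) ⊕ Fin (a s)),
      (C s).run (tensor (tensor (basisState (enc s k)) (zeroState _)) (zeroState _)) =
        tensor g (φ s k)
  /-- Polynomially many copies of `φ s k` for one random `k` are indistinguishable from as many
  copies of a Haar random state. -/
  pseudorandom : ∀ (m : ℕ → ℕ), PolyBounded m → ∀ D : ∀ s, StateDistinguisher (n s) (m s),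
    PolyBounded (fun s => (D s).size) →
    Negligible fun s => |uniformAvg (fun k => (D s).prob (φ s k)) -
      haarStateAvg (n s) (D s).prob|

/-! ## The identification protocol with a high-resource verifier -/

/-- An adversary for the protocol. In the learning phase it queries the oracle, starting from
its work qubits in the state `|0…0⟩`. It then receives the challenge registers, one for every
`t : T`, runs a circuit without oracle on everything it holds, and returns the challenge
registers as its responses. An adversary that has to return a response before it receives the
next challenge is the special case of a circuit `respond` in which no gate on a challenge register
comes after a gate on a later one. -/
structure Adversary (n : ℕ) (T : Type) where
  work : ℕ
  learn : OracleCircuit n (Fin work)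
  respond : Circuit (Fin work ⊕ (T × Fin n))

section Protocol

variable {n : ℕ} {T : Type} [Fintype T] [DecidableEq T]

/-- Number of work qubits, gates and queries. -/
def Adversary.size (A : Adversary n T) : ℕ := A.work + A.learn.length + A.respond.length

/-- Joint state of the work qubits and the responses, when the device is `U` and the challenges
are `c`. -/
noncomputable def Adversary.output (A : Adversary n T) (U : QUnitary (Fin n)) (c : T → QVec (Fin n)) :
    QVec (Fin A.work ⊕ (T × Fin n)) :=
  A.respond.run (tensor (A.learn.run U (zeroState (Fin A.work))) (tensorFamily c))

/-- The state `Ψ` of the adversary's qubits and the responses, next to `M` stored copies of the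
correct response `r t` for every `t : T`. Of the registers `(t, j)`, `j : Fin (M + 1)`, the one
with `j = 0` is the response and the others are the stored copies. -/
def withStored {w : ℕ} (M : ℕ) (Ψ : QVec (Fin w ⊕ (T × Fin n))) (r : T → QVec (Fin n)) :
    QVec (Fin w ⊕ ((T × Fin (M + 1)) × Fin n)) :=
  fun x =>
    Ψ (Sum.elim (fun i => x (Sum.inl i)) fun q => x (Sum.inr ((q.1, 0), q.2))) *
      ∏ t, ∏ j : Fin M, r t fun b => x (Sum.inr ((t, j.succ), b))

/-- Cyclic shift by `v t` of the `M + 1` registers of test `t`, for every `t`. -/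
def shiftRegisters {w M : ℕ} (v : T → Fin (M + 1))
    (Ψ : QVec (Fin w ⊕ ((T × Fin (M + 1)) × Fin n))) :
    QVec (Fin w ⊕ ((T × Fin (M + 1)) × Fin n)) :=
  fun x => Ψ (Sum.elim (fun i => x (Sum.inl i)) fun q =>
    x (Sum.inr ((q.1.1, q.1.2 + v q.1.1), q.2)))

/-- Unnormalised state after all tests have accepted. Test `t` prepares a control in the uniform
superposition over `Fin (M + 1)`, shifts the `M + 1` registers cyclically by its value, and
accepts if the control is found in the uniform superposition again; so its acceptance operator
is the average of the shifts. For `M = 1` this is the SWAP test, `(1 + SWAP) / 2`. In general,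
a single response `ρ` tested against `M` copies of `ψ` is accepted with probability
`1 / (M + 1) + M / (M + 1) * ⟨ψ|ρ|ψ⟩`. -/
noncomputable def afterTests {w M : ℕ} (Ψ : QVec (Fin w ⊕ ((T × Fin (M + 1)) × Fin n))) :
    QVec (Fin w ⊕ ((T × Fin (M + 1)) × Fin n)) :=
  fun x => ((M + 1 : ℂ) ^ Fintype.card T)⁻¹ * ∑ v : T → Fin (M + 1), shiftRegisters v Ψ x

/-- Probability that all tests accept, when every response is tested against `M` stored copies
of the correct response. -/
noncomputable def Adversary.acceptProb (A : Adversary n T) (M : ℕ) (U : QUnitary (Fin n))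
    (c : T → QVec (Fin n)) : ℝ :=
  normSq (afterTests (withStored M (A.output U c) fun t => applyU U (c t)))

end Protocol

section Verification

variable {n : ℕ} {K K' : Type*} [Fintype K] [Fintype K']

open Classical in
/-- Probability that the adversary passes the verification with SWAP tests: the device key `k`
and `N` different challenge keys `κ` are uniformly random, each of the `N` challenges is sent
`M` times, and each of the `N * M` responses is tested against one of the `M` stored copies. -/
noncomputable def swapPass (N M : ℕ) (U : K → QUnitary (Fin n)) (φ : K' → QVec (Fin n))
    (A : Adversary n (Fin N × Fin M)) : ℝ :=
  uniformAvg fun k : K => uniformAvg fun κ : Fin N ↪ K' =>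
    A.acceptProb 1 (U k) fun t => φ (κ t.1)

open Classical in
/-- Probability that the adversary passes the verification with GSWAP tests: the device key `k`
and `N` different challenge keys `κ` are uniformly random, each of the `N` challenges is sent
once, and the response is tested against the `M` stored copies. -/
noncomputable def gswapPass (N M : ℕ) (U : K → QUnitary (Fin n)) (φ : K' → QVec (Fin n))
    (A : Adversary n (Fin N)) : ℝ :=
  uniformAvg fun k : K => uniformAvg fun κ : Fin N ↪ K' =>
    A.acceptProb M (U k) fun t => φ (κ t)

end Verification

end QIdent

/-! A test applies the average of $M+1$ cyclic shifts, so all tests together apply the average of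
$D=(M+1)^{|T|}$ shifts, and the acceptance probability is $D^{-2}$ times the sum of the inner
products of all pairs of shifted states. The $D$ diagonal pairs contribute $1/D$, the probability of
guessing. Two different shifts put the response to some challenge into different registers, and
where one of them has the response the other has a stored copy of the correct state. Hence their
inner product is at most the probability that this response is correct
(`norm_ip_shiftRegisters_le`). The off-diagonal pairs number less than $D^2$, so together they add
at most a common bound on the averaged probabilities of a correct response
(`Adversary.uniformAvg_acceptProb_le`). Entangled responses are covered, and no factor $D$ is lost.

It remains to see that one correct response is negligibly likely. For a Haar random device $V$,
invariance allows $V$ to be replaced by $VW_j$, where $W_j$ exchanges the challenge with the $j$-th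
vector of a basis and $j$ is random. The correct response is then a random vector of a basis, which
a run with oracle $V$ hits with probability $2^{-n}$. By a hybrid argument the run with oracle
$VW_j$ differs only by the weight of the queries on the two exchanged vectors. That weight is small:
$j$ is random, and the learning phase precedes the challenge, which is drawn from an ensemble with
small mean overlap (`Adversary.uniformAvg_integral_hit_le`).

Pseudorandomness enters twice, each time through a swap test. Against one copy of an unknown state
it shows that the PRS overlaps are as small as for Haar random states
(`IsPRS.exists_overlap_bound`). Against the correct response, obtained by one further query, it
shows that a pseudorandom device is answered correctly about as often as a Haar random one
(`IsPRU.exists_hit_bound`). Drawing different instead of independent keys costs a constant factor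
and a term $2N/|\mathcal K'|$ (`uniformAvg_embedding_le`). -/

namespace QIdent

open MeasureTheory Filter

/-! ## Linear algebra on qubit registers -/

section Linear

variable {ι κ ν : Type*} [Fintype ι] [DecidableEq ι] [Fintype κ] [DecidableEq κ]
  [Fintype ν] [DecidableEq ν]

/-- Inner product, conjugate linear in the first argument. -/
noncomputable def ip (φ ψ : QVec ι) : ℂ := ∑ x, star (φ x) * ψ x

/-- Euclidean norm. -/
noncomputable def nrm (φ : QVec ι) : ℝ := ‖WithLp.toLp 2 φ‖

theorem nrm_sq (φ : QVec ι) : nrm φ ^ 2 = normSq φ := by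
  simp [nrm, normSq, EuclideanSpace.norm_sq_eq]

theorem nrm_nonneg (φ : QVec ι) : 0 ≤ nrm φ := norm_nonneg _

theorem normSq_nonneg (φ : QVec ι) : 0 ≤ normSq φ := by rw [← nrm_sq]; positivity

theorem nrm_add_le (φ ψ : QVec ι) : nrm (φ + ψ) ≤ nrm φ + nrm ψ := by
  simpa [nrm] using norm_add_le (WithLp.toLp 2 φ) (WithLp.toLp 2 ψ)

theorem nrm_sub_le (φ ψ : QVec ι) : nrm (φ - ψ) ≤ nrm φ + nrm ψ := by
  simpa [nrm] using norm_sub_le (WithLp.toLp 2 φ) (WithLp.toLp 2 ψ)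

theorem nrm_zero : nrm (0 : QVec ι) = 0 := by simp [nrm]

theorem nrm_of_normSq_eq {φ : QVec ι} {ψ : QVec κ} (h : normSq φ = normSq ψ) : nrm φ = nrm ψ := by
  rw [← nrm_sq, ← nrm_sq] at h
  exact (pow_left_inj₀ (nrm_nonneg _) (nrm_nonneg _) two_ne_zero).mp h

theorem normSq_add_le (φ ψ : QVec ι) : normSq (φ + ψ) ≤ 2 * normSq φ + 2 * normSq ψ := by
  have h := nrm_add_le φ ψ
  simp only [← nrm_sq]
  nlinarith [nrm_nonneg (φ + ψ), sq_nonneg (nrm φ - nrm ψ)]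

theorem ip_self (φ : QVec ι) : ip φ φ = (normSq φ : ℂ) := by
  simp only [ip, normSq, Complex.ofReal_sum, Complex.ofReal_pow]
  refine Finset.sum_congr rfl fun x _ => ?_
  rw [← Complex.conj_mul']; rfl

theorem normSq_eq_re_ip (φ : QVec ι) : normSq φ = (ip φ φ).re := by simp [ip_self]

theorem ip_eq_inner (φ ψ : QVec ι) : ip φ ψ = inner ℂ (WithLp.toLp 2 φ) (WithLp.toLp 2 ψ) := by
  simp [ip, PiLp.inner_apply, mul_comm]

theorem norm_ip_le (φ ψ : QVec ι) : ‖ip φ ψ‖ ≤ nrm φ * nrm ψ := by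
  rw [ip_eq_inner]; exact norm_inner_le_norm _ _

theorem star_ip (φ ψ : QVec ι) : star (ip φ ψ) = ip ψ φ := by
  simp [ip, mul_comm]

theorem ip_sub_right (φ ψ χ : QVec ι) : ip φ (ψ - χ) = ip φ ψ - ip φ χ := by
  simp [ip, mul_sub, Finset.sum_sub_distrib]

theorem ip_sub_left (φ ψ χ : QVec ι) : ip (φ - ψ) χ = ip φ χ - ip ψ χ := by
  simp [ip, sub_mul, Finset.sum_sub_distrib]

theorem ip_smul_right (a : ℂ) (φ ψ : QVec ι) : ip φ (a • ψ) = a * ip φ ψ := by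
  simp only [ip, Pi.smul_apply, smul_eq_mul, Finset.mul_sum]
  exact Finset.sum_congr rfl fun _ _ => by ring

theorem ip_sum_right {α : Type*} (s : Finset α) (φ : QVec ι) (ψ : α → QVec ι) :
    ip φ (∑ a ∈ s, ψ a) = ∑ a ∈ s, ip φ (ψ a) := by
  simp only [ip, Finset.sum_apply, Finset.mul_sum]
  exact Finset.sum_comm

theorem ip_sum_left {α : Type*} (s : Finset α) (φ : QVec ι) (ψ : α → QVec ι) :
    ip (∑ a ∈ s, ψ a) φ = ∑ a ∈ s, ip (ψ a) φ := by
  simp only [ip, Finset.sum_apply, star_sum, Finset.sum_mul]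
  exact Finset.sum_comm

theorem normSq_smul (a : ℂ) (φ : QVec ι) : normSq (a • φ) = ‖a‖ ^ 2 * normSq φ := by
  simp [normSq, mul_pow, Finset.mul_sum]

theorem normSq_sub (φ ψ : QVec ι) :
    normSq (φ - ψ) = normSq φ + normSq ψ - 2 * (ip φ ψ).re := by
  have h : (ip ψ φ).re = (ip φ ψ).re := by rw [← star_ip]; simp
  simp only [normSq_eq_re_ip, ip_sub_left, ip_sub_right, Complex.sub_re, h]; ring

theorem normSq_basisState (b : ι → Bool) : normSq (basisState b) = 1 := by
  simp [normSq, basisState, apply_ite]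

theorem normSq_zeroState : normSq (zeroState ι) = 1 := normSq_basisState _

end Linear

/-! ### Overwriting some qubits -/

section Extend

variable {ι ι' κ ν : Type*}

theorem extend_comp_self (e : κ ↪ ι) (y : κ → Bool) (x : ι → Bool) :
    Function.extend e y x ∘ e = y := Function.extend_comp e.injective _ _

theorem extend_comp_of_disjoint (e : κ ↪ ι) (f : ν → ι) (h : ∀ i j, e i ≠ f j)
    (y : κ → Bool) (x : ι → Bool) : Function.extend e y x ∘ f = x ∘ f := by
  funext j
  exact Function.extend_apply' _ _ _ fun ⟨i, hi⟩ => h i j hi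

theorem extend_extend (e : κ ↪ ι) (y z : κ → Bool) (x : ι → Bool) :
    Function.extend e y (Function.extend e z x) = Function.extend e y x := by
  funext w
  by_cases hw : ∃ i, e i = w
  · obtain ⟨i, rfl⟩ := hw
    simp [e.injective.extend_apply]
  · simp [Function.extend_apply' _ _ _ hw]

theorem extend_self (e : κ ↪ ι) (x : ι → Bool) : Function.extend e (x ∘ e) x = x := by
  funext w
  by_cases hw : ∃ i, e i = w
  · obtain ⟨i, rfl⟩ := hw
    simp [e.injective.extend_apply]
  · simp [Function.extend_apply' _ _ _ hw]

theorem extend_extend_comm (e : κ ↪ ι) (f : ν ↪ ι) (h : ∀ i j, e i ≠ f j)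
    (y : κ → Bool) (z : ν → Bool) (x : ι → Bool) :
    Function.extend f z (Function.extend e y x) = Function.extend e y (Function.extend f z x) := by
  funext w
  by_cases hw : ∃ i, e i = w
  · obtain ⟨i, rfl⟩ := hw
    have h' : ¬ ∃ j, f j = e i := fun ⟨j, hj⟩ => h i j hj.symm
    simp [e.injective.extend_apply, Function.extend_apply' _ _ _ h']
  · by_cases hw' : ∃ j, f j = w
    · obtain ⟨j, rfl⟩ := hw'
      simp [f.injective.extend_apply, Function.extend_apply' _ _ _ hw]
    · simp [Function.extend_apply' _ _ _ hw, Function.extend_apply' _ _ _ hw']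

theorem extend_trans (e : κ ↪ ν) (j : ν ↪ ι) (y : κ → Bool) (x : ι → Bool) :
    Function.extend (e.trans j) y x =
      Function.extend j (Function.extend e y (x ∘ j)) x := by
  funext w
  by_cases hw : ∃ i, j i = w
  · obtain ⟨i, rfl⟩ := hw
    rw [j.injective.extend_apply]
    by_cases hi : ∃ k, e k = i
    · obtain ⟨k, rfl⟩ := hi
      rw [e.injective.extend_apply]
      exact (e.trans j).injective.extend_apply y x k
    · rw [Function.extend_apply' _ _ _ hi, Function.extend_apply']
      · rfl
      · rintro ⟨k, hk⟩
        exact hi ⟨k, j.injective hk⟩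
  · rw [Function.extend_apply' _ _ _ hw, Function.extend_apply']
    rintro ⟨k, hk⟩
    exact hw ⟨e k, hk⟩

/-- `f` does not depend on the qubits `e`. -/
def IndepOf {α : Type*} (e : κ ↪ ι) (f : (ι → Bool) → α) : Prop :=
  ∀ y x, f (Function.extend e y x) = f x

end Extend

/-! ### Operators on some of the qubits -/

section ApplyOn

variable {ι α κ ν : Type*} [Fintype κ] [DecidableEq κ] [Fintype ν] [DecidableEq ν]

theorem applyOn_add (e : κ ↪ ι) (G : Matrix (κ → Bool) (κ → Bool) ℂ) (φ ψ : QVec ι) :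
    applyOn e G (φ + ψ) = applyOn e G φ + applyOn e G ψ := by
  funext x; simp [applyOn, mul_add, Finset.sum_add_distrib]

theorem applyOn_sub (e : κ ↪ ι) (G : Matrix (κ → Bool) (κ → Bool) ℂ) (φ ψ : QVec ι) :
    applyOn e G (φ - ψ) = applyOn e G φ - applyOn e G ψ := by
  funext x; simp [applyOn, mul_sub, Finset.sum_sub_distrib]

theorem applyOn_smul (e : κ ↪ ι) (G : Matrix (κ → Bool) (κ → Bool) ℂ) (a : ℂ) (ψ : QVec ι) :
    applyOn e G (a • ψ) = a • applyOn e G ψ := by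
  funext x
  simp only [applyOn, Pi.smul_apply, smul_eq_mul, Finset.mul_sum]
  exact Finset.sum_congr rfl fun _ _ => by ring

theorem applyOn_matrix_add (e : κ ↪ ι) (G H : Matrix (κ → Bool) (κ → Bool) ℂ) (ψ : QVec ι) :
    applyOn e (G + H) ψ = applyOn e G ψ + applyOn e H ψ := by
  funext x; simp [applyOn, add_mul, Finset.sum_add_distrib]

theorem applyOn_matrix_sub (e : κ ↪ ι) (G H : Matrix (κ → Bool) (κ → Bool) ℂ) (ψ : QVec ι) :
    applyOn e (G - H) ψ = applyOn e G ψ - applyOn e H ψ := by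
  funext x; simp [applyOn, sub_mul, Finset.sum_sub_distrib]

theorem applyOn_matrix_sum (s : Finset α) (e : κ ↪ ι)
    (G : α → Matrix (κ → Bool) (κ → Bool) ℂ) (ψ : QVec ι) :
    applyOn e (∑ a ∈ s, G a) ψ = ∑ a ∈ s, applyOn e (G a) ψ := by
  funext x
  simp only [applyOn, Matrix.sum_apply, Finset.sum_mul, Finset.sum_apply]
  exact Finset.sum_comm

theorem applyOn_one (e : κ ↪ ι) (ψ : QVec ι) : applyOn e 1 ψ = ψ := by
  funext x; simp [applyOn, Matrix.one_apply, extend_self]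

theorem applyOn_mul (e : κ ↪ ι) (G H : Matrix (κ → Bool) (κ → Bool) ℂ) (ψ : QVec ι) :
    applyOn e (G * H) ψ = applyOn e G (applyOn e H ψ) := by
  funext x
  simp only [applyOn, Matrix.mul_apply, Finset.sum_mul, Finset.mul_sum, extend_extend,
    extend_comp_self]
  rw [Finset.sum_comm]
  exact Finset.sum_congr rfl fun _ _ => Finset.sum_congr rfl fun _ _ => by ring

theorem applyOn_comm (e : κ ↪ ι) (f : ν ↪ ι) (h : ∀ i j, e i ≠ f j)
    (G : Matrix (κ → Bool) (κ → Bool) ℂ) (H : Matrix (ν → Bool) (ν → Bool) ℂ) (ψ : QVec ι) :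
    applyOn e G (applyOn f H ψ) = applyOn f H (applyOn e G ψ) := by
  funext x
  simp only [applyOn, Finset.mul_sum, extend_comp_of_disjoint e f h,
    extend_comp_of_disjoint f e fun i j => (h j i).symm]
  rw [Finset.sum_comm]
  refine Finset.sum_congr rfl fun _ _ => Finset.sum_congr rfl fun _ _ => ?_
  rw [extend_extend_comm e f h]; ring

theorem applyOn_trans (e : κ ↪ α) (j : α ↪ ι) (G : Matrix (κ → Bool) (κ → Bool) ℂ)
    (ψ : QVec ι) (x : ι → Bool) :
    applyOn (e.trans j) G ψ x =
      applyOn e G (fun y => ψ (Function.extend j y x)) (x ∘ j) := by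
  simp only [applyOn, extend_trans]; rfl

/-- An operator on a tensor factor. -/
theorem applyOn_mul_of_indep (e : κ ↪ ι) (G : Matrix (κ → Bool) (κ → Bool) ℂ)
    {h : QVec ι} (hh : IndepOf e h) (ψ : QVec ι) :
    applyOn e G (fun x => ψ x * h x) = fun x => applyOn e G ψ x * h x := by
  funext x
  simp only [applyOn, hh _ x, Finset.sum_mul, mul_assoc]

theorem applyOn_comp_trans (e : κ ↪ α) (j : α ↪ ι) (G : Matrix (κ → Bool) (κ → Bool) ℂ)
    (f : QVec α) : applyOn (e.trans j) G (fun x => f (x ∘ j)) = fun x => applyOn e G f (x ∘ j) := by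
  funext x
  rw [applyOn_trans]
  simp only [extend_comp_self]

/-- Permuting the qubits. -/
theorem applyOn_perm (e : κ ↪ ι) (π : Equiv.Perm ι) (G : Matrix (κ → Bool) (κ → Bool) ℂ)
    (ψ : QVec ι) :
    applyOn (e.trans π.toEmbedding) G (fun x => ψ (x ∘ π)) = fun x => applyOn e G ψ (x ∘ π) :=
  applyOn_comp_trans e π.toEmbedding G ψ

/-- Orthogonal projection onto the span of a unit vector. -/
def proj {κ : Type*} (r : QVec κ) : Matrix (κ → Bool) (κ → Bool) ℂ := Matrix.vecMulVec r (star r)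

theorem proj_conjTranspose {κ : Type*} (r : QVec κ) : (proj r).conjTranspose = proj r := by
  ext x y; simp [proj, Matrix.vecMulVec_apply, Matrix.conjTranspose_apply, mul_comm]

theorem proj_mul_self {r : QVec κ} (hr : normSq r = 1) : proj r * proj r = proj r := by
  have h : star r ⬝ᵥ r = 1 := by
    have := ip_self r
    rw [hr] at this
    simpa [ip, dotProduct] using this
  rw [proj, Matrix.vecMulVec_mul_vecMulVec, h]; simp

theorem applyOn_proj_apply (e : κ ↪ ι) (r : QVec κ) (ψ : QVec ι) (x : ι → Bool) :
    applyOn e (proj r) ψ x = r (x ∘ e) * ip r fun y => ψ (Function.extend e y x) := by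
  simp only [applyOn, proj, Matrix.vecMulVec_apply, ip, Finset.mul_sum, mul_assoc]; rfl

/-- The projection fixes a state that is `r` on the qubits `e`. -/
theorem applyOn_proj_of_eq (e : κ ↪ ι) {r : QVec κ} (hr : normSq r = 1)
    {h : QVec ι} (hh : IndepOf e h) :
    applyOn e (proj r) (fun x => r (x ∘ e) * h x) = fun x => r (x ∘ e) * h x := by
  rw [applyOn_mul_of_indep e _ hh fun x => r (x ∘ e)]
  funext x
  rw [applyOn_proj_apply]
  simp only [extend_comp_self]
  rw [show ip r (fun y => r y) = 1 by rw [ip_self, hr]; simp, mul_one]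

end ApplyOn

/-! ### Adjoints and norms of operators on some of the qubits. -/

section ApplyOnInner

variable {ι κ ν : Type*} [Fintype ι] [DecidableEq ι] [Fintype κ] [DecidableEq κ]
  [Fintype ν] [DecidableEq ν]

/-- Exchanging $y$ with the bits of $x$ at the positions `e` is an involution on pairs. This change
of variables replaces a splitting of the register into `e` and its complement. -/
theorem sum_extend {α : Type*} [AddCommMonoid α] (e : κ ↪ ι) (f : (ι → Bool) → (κ → Bool) → α) :
    ∑ x, ∑ y, f (Function.extend e y x) (x ∘ e) = ∑ x, ∑ y, f x y := by
  rw [← Fintype.sum_prod_type', ← Fintype.sum_prod_type']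
  let g : (ι → Bool) × (κ → Bool) → (ι → Bool) × (κ → Bool) :=
    fun p => (Function.extend e p.2 p.1, p.1 ∘ e)
  have hg : Function.Involutive g := by
    rintro ⟨x, y⟩
    simp [g, extend_extend, extend_self, extend_comp_self]
  exact Equiv.sum_comp hg.toPerm fun p => f p.1 p.2

theorem ip_applyOn (e : κ ↪ ι) (G : Matrix (κ → Bool) (κ → Bool) ℂ) (φ ψ : QVec ι) :
    ip φ (applyOn e G ψ) = ip (applyOn e G.conjTranspose φ) ψ := by
  simp only [ip, applyOn, star_sum, Finset.sum_mul, Finset.mul_sum]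
  rw [← sum_extend e]
  refine Finset.sum_congr rfl fun x _ => Finset.sum_congr rfl fun y _ => ?_
  simp only [extend_extend, extend_self, extend_comp_self, Matrix.conjTranspose_apply, star_mul',
    star_star]
  ring

theorem ip_applyOn_proj (e : κ ↪ ι) (r : QVec κ) (φ ψ : QVec ι) :
    ip φ (applyOn e (proj r) ψ) = ip (applyOn e (proj r) φ) ψ := by
  rw [ip_applyOn, proj_conjTranspose]

theorem normSq_applyOn (e : κ ↪ ι) (G : Matrix (κ → Bool) (κ → Bool) ℂ) (ψ : QVec ι) :
    normSq (applyOn e G ψ) = (ip ψ (applyOn e (G.conjTranspose * G) ψ)).re := by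
  rw [normSq_eq_re_ip, applyOn_mul, ip_applyOn e G.conjTranspose, Matrix.conjTranspose_conjTranspose]

theorem normSq_applyOn_unitary (e : κ ↪ ι) (U : QUnitary κ) (ψ : QVec ι) :
    normSq (applyOn e (U : Matrix _ _ ℂ) ψ) = normSq ψ := by
  have h : (U : Matrix (κ → Bool) (κ → Bool) ℂ).conjTranspose * U = 1 :=
    Matrix.mem_unitaryGroup_iff'.mp U.2
  rw [normSq_applyOn, h, applyOn_one, normSq_eq_re_ip]

theorem normSq_proj (e : κ ↪ ι) {r : QVec κ} (hr : normSq r = 1) (ψ : QVec ι) :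
    normSq (applyOn e (proj r) ψ) = (ip ψ (applyOn e (proj r) ψ)).re := by
  rw [normSq_applyOn, proj_conjTranspose, proj_mul_self hr]

/-- From $\|P\psi\|^2=\langle\psi,P\psi\rangle\le\|\psi\|\,\|P\psi\|$, by cancelling $\|P\psi\|$
when it is not zero. -/
theorem normSq_proj_le (e : κ ↪ ι) {r : QVec κ} (hr : normSq r = 1) (ψ : QVec ι) :
    normSq (applyOn e (proj r) ψ) ≤ normSq ψ := by
  have h1 := normSq_proj e hr ψ
  have h2 := (Complex.re_le_norm _).trans (norm_ip_le ψ (applyOn e (proj r) ψ))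
  rw [← h1, ← nrm_sq] at h2
  rw [← nrm_sq, ← nrm_sq]
  rcases (nrm_nonneg (applyOn e (proj r) ψ)).eq_or_lt with h | h
  · rw [← h]; nlinarith [nrm_nonneg ψ]
  · have : nrm (applyOn e (proj r) ψ) ≤ nrm ψ := by nlinarith
    nlinarith [nrm_nonneg ψ]

/-- Frobenius norm bound. -/
theorem normSq_applyOn_le (e : κ ↪ ι) (G : Matrix (κ → Bool) (κ → Bool) ℂ) (ψ : QVec ι) :
    normSq (applyOn e G ψ) ≤ (∑ y, ∑ z, ‖G y z‖ ^ 2) * normSq ψ := by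
  have h1 : ∀ x, ‖applyOn e G ψ x‖ ^ 2 ≤
      (∑ z, ‖G (x ∘ e) z‖ ^ 2) * ∑ z, ‖ψ (Function.extend e z x)‖ ^ 2 := by
    intro x
    refine le_trans ?_ (Finset.sum_mul_sq_le_sq_mul_sq _ _ _)
    gcongr
    refine (norm_sum_le _ _).trans_eq ?_
    simp
  refine (Finset.sum_le_sum fun x _ => h1 x).trans_eq ?_
  simp only [Finset.mul_sum]
  rw [← sum_extend e]
  simp only [extend_extend, extend_self, extend_comp_self, normSq, Finset.sum_mul, Finset.mul_sum]

/-- Norm of a tensor product. -/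
theorem normSq_mul_of_indep (j : κ ↪ ι) (f : QVec κ) {h : QVec ι} (hh : IndepOf j h) :
    normSq (fun x => f (x ∘ j) * h x) * Fintype.card (κ → Bool) = normSq f * normSq h := by
  -- As a function of all qubits `h` repeats each of its values $2^{|\kappa|}$ times, which explains
  -- the extra factor on the left-hand side.
  have h1 : ∑ x, ∑ _y : κ → Bool, ‖f (x ∘ j) * h x‖ ^ 2 =
      ∑ x, ∑ y, ‖f y‖ ^ 2 * ‖h x‖ ^ 2 := by
    rw [← sum_extend j fun x y => ‖f y‖ ^ 2 * ‖h x‖ ^ 2]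
    simp [hh _ _, mul_pow]
  simp only [Finset.sum_const, Finset.card_univ, nsmul_eq_mul] at h1
  rw [normSq, mul_comm, Finset.mul_sum, h1]
  simp only [normSq, Finset.mul_sum, Finset.sum_mul]

/-- Normalisation of one product fixes the norm of `h`, so `f` can be exchanged for `f'` without
regarding `h` as a state of the remaining qubits. -/
theorem normSq_mul_of_indep_congr (j : κ ↪ ι) {f f' : QVec κ} (hf : normSq f = 1) {h : QVec ι}
    (hh : IndepOf j h) (h1 : normSq (fun x => f (x ∘ j) * h x) = 1) :
    normSq (fun x => f' (x ∘ j) * h x) = normSq f' := by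
  have a := normSq_mul_of_indep j f hh
  have b := normSq_mul_of_indep j f' hh
  rw [hf, h1, one_mul, one_mul] at a
  have c : (Fintype.card (κ → Bool) : ℝ) ≠ 0 := by simp
  rw [← a] at b
  exact mul_right_cancel₀ c b

theorem normSq_mul_comp (j : κ ↪ ι) (k : ν ↪ ι) (hd : ∀ a b, j a ≠ k b)
    (hc : Fintype.card ι = Fintype.card κ + Fintype.card ν) (f : QVec κ) (g : QVec ν) :
    normSq (fun x => f (x ∘ j) * g (x ∘ k)) = normSq f * normSq g := by
  have a := normSq_mul_of_indep (h := fun x => g (x ∘ k)) j f fun y x => by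
    simp only [extend_comp_of_disjoint j k hd]
  -- The other factor is the constant 1, whose squared norm counts all bit strings; by `hc` the
  -- powers of two then cancel.
  have b := normSq_mul_of_indep (h := fun _ => (1 : ℂ)) k g fun y x => rfl
  simp only [mul_one] at b
  have c : normSq (fun _ : ι → Bool => (1 : ℂ)) = 2 ^ Fintype.card ι := by simp [normSq]
  rw [c, hc] at b
  simp only [Fintype.card_fun, Fintype.card_bool, Nat.cast_pow, Nat.cast_ofNat] at a b
  have p : (0 : ℝ) < 2 ^ Fintype.card κ := by positivity
  have q : (0 : ℝ) < 2 ^ Fintype.card ν := by positivity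
  rw [pow_add, ← mul_assoc] at b
  have b' := mul_right_cancel₀ q.ne' b
  rw [b', ← mul_assoc] at a
  exact mul_right_cancel₀ p.ne' a

theorem normSq_tensor (φ : QVec ι) (χ : QVec κ) : normSq (tensor φ χ) = normSq φ * normSq χ :=
  normSq_mul_comp Function.Embedding.inl Function.Embedding.inr (by simp) (by simp) φ χ

theorem normSq_tensorFamily {T : Type*} [Fintype T] [DecidableEq T] (φ : T → QVec ι) :
    normSq (tensorFamily φ) = ∏ t, normSq (φ t) := by
  simp only [normSq, tensorFamily, norm_prod, ← Finset.prod_pow]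
  rw [Finset.prod_univ_sum, Fintype.piFinset_univ]
  exact Fintype.sum_equiv (Equiv.curry T ι Bool) _ _ fun x => rfl

theorem normSq_applyU (U : QUnitary ι) (φ : QVec ι) : normSq (applyU U φ) = normSq φ := by
  have h := normSq_applyOn_unitary (Function.Embedding.refl ι) U φ
  have : applyOn (Function.Embedding.refl ι) (U : Matrix _ _ ℂ) φ = applyU U φ := by
    funext x
    simp only [applyOn, applyU, Matrix.mulVec, dotProduct]
    refine Finset.sum_congr rfl fun y _ => ?_
    congr 2
    funext i
    exact (Function.Embedding.refl ι).injective.extend_apply y x i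
  rwa [this] at h

end ApplyOnInner

/-! ## Circuits -/

section MapCircuit

variable {α ι : Type*}

theorem Circuit.run_nil (ψ : QVec ι) : Circuit.run ([] : Circuit ι) ψ = ψ := rfl

theorem Circuit.run_cons (g : Gate ι) (C : Circuit ι) (ψ : QVec ι) :
    Circuit.run (g :: C) ψ = Circuit.run C (g.apply ψ) := rfl

theorem Circuit.run_append (C D : Circuit ι) (ψ : QVec ι) :
    Circuit.run (C ++ D) ψ = Circuit.run D (C.run ψ) := List.foldl_append

theorem Circuit.run_smul (C : Circuit ι) (a : ℂ) (ψ : QVec ι) :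
    C.run (a • ψ) = a • C.run ψ := by
  induction C generalizing ψ with
  | nil => rfl
  | cons g C ih => rw [run_cons, run_cons, Gate.apply, applyOn_smul, ih]; rfl

theorem Circuit.run_sub (C : Circuit ι) (φ ψ : QVec ι) :
    C.run (φ - ψ) = C.run φ - C.run ψ := by
  induction C generalizing φ ψ with
  | nil => rfl
  | cons g C ih => rw [run_cons, run_cons, run_cons, Gate.apply, applyOn_sub, ih]; rfl

/-- The gate on a larger register. -/
def Gate.map (j : α ↪ ι) (g : Gate α) : Gate ι := { g with wires := g.wires.trans j }

/-- The circuit on a larger register. -/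
def Circuit.map (j : α ↪ ι) (C : Circuit α) : Circuit ι := List.map (Gate.map j) C

theorem Circuit.length_map (j : α ↪ ι) (C : Circuit α) :
    (Circuit.map j C).length = C.length := List.length_map _

theorem Gate.map_apply (j : α ↪ ι) (g : Gate α) (ψ : QVec ι) (x : ι → Bool) :
    (g.map j).apply ψ x = g.apply (fun y => ψ (Function.extend j y x)) (x ∘ j) :=
  applyOn_trans _ _ _ _ _

/-- With the bits outside `j` fixed, a state becomes a function of the bits in `j`, and the circuit
acts on each such slice separately. -/
theorem Circuit.run_map (j : α ↪ ι) (C : Circuit α) (ψ : QVec ι) (x : ι → Bool) :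
    (C.map j).run ψ x = C.run (fun y => ψ (Function.extend j y x)) (x ∘ j) := by
  induction C generalizing ψ with
  | nil => simp [Circuit.map, Circuit.run, extend_self]
  | cons g C ih =>
    change Circuit.run (Circuit.map j C) ((g.map j).apply ψ) x = _
    rw [ih]
    simp only [Gate.map_apply, extend_extend, extend_comp_self]
    rfl

/-- A circuit acting on a tensor factor. -/
theorem Circuit.run_map_mul (j : α ↪ ι) (C : Circuit α) (f : QVec α) {h : QVec ι}
    (hh : IndepOf j h) :
    (C.map j).run (fun x => f (x ∘ j) * h x) = fun x => C.run f (x ∘ j) * h x := by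
  funext x
  rw [Circuit.run_map]
  have : (fun y => f (Function.extend j y x ∘ j) * h (Function.extend j y x)) = h x • f := by
    funext y
    simp [extend_comp_self, hh y x, mul_comm]
  rw [this, Circuit.run_smul]
  simp [mul_comm]

variable {n : ℕ}

theorem OracleCircuit.run_cons (st : OracleStep n ι) (C : OracleCircuit n ι) (U : QUnitary (Fin n))
    (ψ : QVec ι) : OracleCircuit.run (st :: C) U ψ = OracleCircuit.run C U (st.apply U ψ) := rfl

theorem OracleCircuit.run_append (C D : OracleCircuit n ι) (U : QUnitary (Fin n)) (ψ : QVec ι) :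
    OracleCircuit.run (C ++ D) U ψ = OracleCircuit.run D U (C.run U ψ) := List.foldl_append

/-- A circuit as a circuit with oracle. -/
def Circuit.toOracle (n : ℕ) (C : Circuit ι) : OracleCircuit n ι := List.map OracleStep.gate C

theorem Circuit.length_toOracle (C : Circuit ι) : (C.toOracle n).length = C.length :=
  List.length_map _

theorem Circuit.run_toOracle (C : Circuit ι) (U : QUnitary (Fin n)) (ψ : QVec ι) :
    (C.toOracle n).run U ψ = C.run ψ := by
  induction C generalizing ψ with
  | nil => rfl
  | cons g C ih => exact ih _

/-- The step on a larger register. -/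
def OracleStep.map (j : α ↪ ι) : OracleStep n α → OracleStep n ι
  | .gate g => .gate (g.map j)
  | .query e => .query (e.trans j)

/-- The circuit with oracle on a larger register. -/
def OracleCircuit.map (j : α ↪ ι) (C : OracleCircuit n α) : OracleCircuit n ι :=
  List.map (OracleStep.map j) C

theorem OracleCircuit.length_map (j : α ↪ ι) (C : OracleCircuit n α) :
    (OracleCircuit.map j C).length = C.length := List.length_map _

theorem OracleStep.map_apply (j : α ↪ ι) (st : OracleStep n α) (U : QUnitary (Fin n))
    (ψ : QVec ι) (x : ι → Bool) :
    (st.map j).apply U ψ x = st.apply U (fun y => ψ (Function.extend j y x)) (x ∘ j) := by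
  cases st <;> exact applyOn_trans _ _ _ _ _

theorem OracleCircuit.run_map (j : α ↪ ι) (C : OracleCircuit n α) (U : QUnitary (Fin n))
    (ψ : QVec ι) (x : ι → Bool) :
    (C.map j).run U ψ x = C.run U (fun y => ψ (Function.extend j y x)) (x ∘ j) := by
  induction C generalizing ψ with
  | nil => simp [OracleCircuit.map, OracleCircuit.run, extend_self]
  | cons st C ih =>
    change OracleCircuit.run (OracleCircuit.map j C) U ((st.map j).apply U ψ) x = _
    rw [ih]
    simp only [OracleStep.map_apply, extend_extend, extend_comp_self]
    rfl

theorem OracleCircuit.run_smul (C : OracleCircuit n ι) (U : QUnitary (Fin n)) (a : ℂ)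
    (ψ : QVec ι) : C.run U (a • ψ) = a • C.run U ψ := by
  induction C generalizing ψ with
  | nil => rfl
  | cons st C ih =>
    have : st.apply U (a • ψ) = a • st.apply U ψ := by cases st <;> exact applyOn_smul _ _ _ _
    rw [run_cons, run_cons, this, ih]

/-- A circuit with oracle acting on a tensor factor. -/
theorem OracleCircuit.run_map_mul (j : α ↪ ι) (C : OracleCircuit n α) (U : QUnitary (Fin n))
    (f : QVec α) {h : QVec ι} (hh : IndepOf j h) :
    (C.map j).run U (fun x => f (x ∘ j) * h x) = fun x => C.run U f (x ∘ j) * h x := by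
  funext x
  rw [OracleCircuit.run_map]
  have : (fun y => f (Function.extend j y x ∘ j) * h (Function.extend j y x)) = h x • f := by
    funext y
    simp [extend_comp_self, hh y x, mul_comm]
  rw [this, OracleCircuit.run_smul]
  simp [mul_comm]

/-- The inputs of the oracle queries, with the qubits they are made on. -/
noncomputable def OracleCircuit.queries (U : QUnitary (Fin n)) :
    OracleCircuit n ι → QVec ι → List ((Fin n ↪ ι) × QVec ι)
  | [], _ => []
  | .gate g :: C, ψ => queries U C (g.apply ψ)
  | .query e :: C, ψ => (e, ψ) :: queries U C (applyOn e (U : Matrix _ _ ℂ) ψ)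

theorem OracleCircuit.length_queries_le (U : QUnitary (Fin n)) (C : OracleCircuit n ι)
    (ψ : QVec ι) : (queries U C ψ).length ≤ C.length := by
  induction C generalizing ψ with
  | nil => simp [queries]
  | cons st C ih =>
    cases st with
    | gate g => exact (ih _).trans (by simp)
    | query e => simpa [queries] using ih _

theorem OracleStep.continuous_apply {X : Type*} [TopologicalSpace X] (st : OracleStep n ι)
    {V : X → QUnitary (Fin n)} (hV : Continuous V) {ψ : X → QVec ι} (hψ : Continuous ψ) :
    Continuous fun a => st.apply (V a) (ψ a) := by
  have hV' : ∀ i j, Continuous fun a => (V a : Matrix (Fin n → Bool) (Fin n → Bool) ℂ) i j :=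
    fun i j => (continuous_subtype_val.comp hV).matrix_elem i j
  have hψ' : ∀ x, Continuous fun a => ψ a x := fun x => (_root_.continuous_apply x).comp hψ
  refine continuous_pi fun x => ?_
  cases st with
  | gate g =>
    exact continuous_finsetSum _ fun y _ => continuous_const.mul (hψ' _)
  | query e =>
    exact continuous_finsetSum _ fun y _ => (hV' _ _).mul (hψ' _)

theorem OracleCircuit.continuous_run {X : Type*} [TopologicalSpace X] (C : OracleCircuit n ι)
    {V : X → QUnitary (Fin n)} (hV : Continuous V) {ψ : X → QVec ι} (hψ : Continuous ψ) :
    Continuous fun a => C.run (V a) (ψ a) := by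
  induction C generalizing ψ with
  | nil => exact hψ
  | cons st C ih => exact ih (st.continuous_apply hV hψ)

theorem Circuit.continuous_run {X : Type*} [TopologicalSpace X] (C : Circuit ι)
    {ψ : X → QVec ι} (hψ : Continuous ψ) : Continuous fun a => C.run (ψ a) := by
  -- A circuit is an oracle circuit without queries, so the constant oracle on no qubits serves.
  have := OracleCircuit.continuous_run (n := 0) (C.toOracle 0) (V := fun _ : X => 1)
    continuous_const hψ
  simpa [Circuit.run_toOracle] using this

end MapCircuit

/-! ### Norm preservation and the hybrid argument for oracle queries. -/

section CircuitNorm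

variable {ι : Type*} [Fintype ι] [DecidableEq ι] {n : ℕ}

theorem Circuit.normSq_run (C : Circuit ι) (ψ : QVec ι) : normSq (C.run ψ) = normSq ψ := by
  induction C generalizing ψ with
  | nil => rfl
  | cons g C ih => rw [run_cons, ih, Gate.apply, normSq_applyOn_unitary]

theorem OracleStep.normSq_apply (st : OracleStep n ι) (U : QUnitary (Fin n)) (ψ : QVec ι) :
    normSq (st.apply U ψ) = normSq ψ := by
  cases st <;> exact normSq_applyOn_unitary _ _ _

theorem OracleCircuit.normSq_run (C : OracleCircuit n ι) (U : QUnitary (Fin n)) (ψ : QVec ι) :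
    normSq (C.run U ψ) = normSq ψ := by
  induction C generalizing ψ with
  | nil => rfl
  | cons st C ih => rw [run_cons, ih, st.normSq_apply]

theorem OracleCircuit.normSq_of_mem_queries (U : QUnitary (Fin n)) (C : OracleCircuit n ι)
    (ψ : QVec ι) : ∀ q ∈ queries U C ψ, normSq q.2 = normSq ψ := by
  induction C generalizing ψ with
  | nil => simp [queries]
  | cons st C ih =>
    cases st with
    | gate g =>
      intro q hq
      rw [ih _ q hq]
      exact normSq_applyOn_unitary _ _ _
    | query e =>
      intro q hq
      rcases List.mem_cons.mp hq with rfl | hq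
      · rfl
      · rw [ih _ q hq]
        exact normSq_applyOn_unitary _ _ _

/-- Changing the oracle from `U` to `U * W` changes the output by at most the sum of the
changes of the query inputs under `W`. -/
theorem OracleCircuit.nrm_run_sub_le (U W : QUnitary (Fin n)) (C : OracleCircuit n ι)
    (ψ' ψ : QVec ι) :
    nrm (C.run (U * W) ψ' - C.run U ψ) ≤ nrm (ψ' - ψ) +
      ((queries U C ψ).map fun q => nrm (applyOn q.1 ((W : Matrix _ _ ℂ) - 1) q.2)).sum := by
  induction C generalizing ψ ψ' with
  | nil => simp [queries, OracleCircuit.run]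
  | cons st C ih =>
    rw [run_cons, run_cons]
    refine (ih _ _).trans ?_
    cases st with
    | gate g =>
      have h : nrm (g.apply ψ' - g.apply ψ) = nrm (ψ' - ψ) := by
        refine nrm_of_normSq_eq ?_
        rw [Gate.apply, Gate.apply, ← applyOn_sub, normSq_applyOn_unitary]
      exact add_le_add h.le le_rfl
    | query e =>
      -- $UW\psi'-U\psi=U\,(W(\psi'-\psi)+(W-1)\psi)$: the old error keeps its norm, and the new
      -- error involves only the query input of the run with oracle `U`, which does not depend on
      -- `W`.
      have h : nrm (applyOn e ((U * W : QUnitary (Fin n)) : Matrix _ _ ℂ) ψ' -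
          applyOn e (U : Matrix _ _ ℂ) ψ) ≤
          nrm (ψ' - ψ) + nrm (applyOn e ((W : Matrix _ _ ℂ) - 1) ψ) := by
        have h1 : applyOn e ((U * W : QUnitary (Fin n)) : Matrix _ _ ℂ) ψ' -
            applyOn e (U : Matrix _ _ ℂ) ψ = applyOn e (U : Matrix _ _ ℂ)
              (applyOn e (W : Matrix _ _ ℂ) (ψ' - ψ) +
                applyOn e ((W : Matrix _ _ ℂ) - 1) ψ) := by
          rw [Submonoid.coe_mul, applyOn_mul, ← applyOn_sub, applyOn_matrix_sub, applyOn_one,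
            applyOn_sub e (W : Matrix _ _ ℂ)]
          congr 1
          abel
        rw [h1, nrm_of_normSq_eq (normSq_applyOn_unitary e U _)]
        refine (nrm_add_le _ _).trans (add_le_add (le_of_eq ?_) le_rfl)
        exact nrm_of_normSq_eq (normSq_applyOn_unitary e W _)
      simp only [queries, List.map_cons, List.sum_cons, OracleStep.apply]
      linarith

end CircuitNorm

theorem List.sq_sum_map_le {α : Type*} (l : List α) (f : α → ℝ) :
    (l.map f).sum ^ 2 ≤ l.length * (l.map fun a => f a ^ 2).sum := by
  rw [← Fin.sum_univ_fun_getElem, ← Fin.sum_univ_fun_getElem l fun a => f a ^ 2]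
  simpa using sq_sum_le_card_mul_sum_sq (s := Finset.univ) (f := fun i : Fin l.length => f l[i.1])

/-! ## The swap test -/

section Gates

/-- Permutation matrix. -/
def permMatrix {α : Type*} [DecidableEq α] (τ : α → α) : Matrix α α ℂ :=
  fun y z => if z = τ y then 1 else 0

theorem permMatrix_mem {α : Type*} [Fintype α] [DecidableEq α] {τ : α → α}
    (hτ : Function.Injective τ) : permMatrix τ ∈ Matrix.unitaryGroup α ℂ := by
  rw [Matrix.mem_unitaryGroup_iff]
  ext y z
  simp [permMatrix, Matrix.mul_apply, Matrix.star_apply, Matrix.one_apply, apply_ite, hτ.eq_iff,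
    eq_comm]

theorem applyOn_permMatrix {ι κ : Type*} [Fintype κ] [DecidableEq κ] (e : κ ↪ ι)
    (τ : (κ → Bool) → (κ → Bool)) (ψ : QVec ι) :
    applyOn e (permMatrix τ) ψ = fun x => ψ (Function.extend e (τ (x ∘ e)) x) := by
  funext x; simp [applyOn, permMatrix]

/-- The Hadamard matrix. -/
noncomputable def hadamardMatrix : Matrix (Fin 1 → Bool) (Fin 1 → Bool) ℂ :=
  fun y z => ((√2)⁻¹ : ℝ) * if y 0 = true ∧ z 0 = true then -1 else 1

theorem sum_fin_one_bool {α : Type*} [AddCommMonoid α] (f : (Fin 1 → Bool) → α) :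
    ∑ y, f y = f (fun _ => false) + f (fun _ => true) := by
  rw [← (Equiv.funUnique (Fin 1) Bool).symm.sum_comp f, Fintype.sum_bool, add_comm]
  rfl

theorem sqrt_two_inv_mul_self : (((√2)⁻¹ : ℝ) : ℂ) * (((√2)⁻¹ : ℝ) : ℂ) = 1 / 2 := by
  rw [← Complex.ofReal_mul, ← mul_inv, Real.mul_self_sqrt (by norm_num)]
  norm_num

theorem hadamardMatrix_mem : hadamardMatrix ∈ Matrix.unitaryGroup (Fin 1 → Bool) ℂ := by
  rw [Matrix.mem_unitaryGroup_iff]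
  ext y z
  have hyz : y = z ↔ y 0 = z 0 := by
    constructor
    · rintro rfl; rfl
    · intro h; funext i; rw [Subsingleton.elim i 0, h]
  simp only [Matrix.mul_apply, Matrix.star_apply, Matrix.one_apply, sum_fin_one_bool,
    hadamardMatrix, hyz, star_mul']
  have h := sqrt_two_inv_mul_self
  cases y 0 <;> cases z 0 <;> simp <;> simp at h <;> linear_combination 2 * h

end Gates

section SwapTest

variable {ι : Type*} [DecidableEq ι]

/-- One wire. -/
def wire {ι : Type*} (a : ι) : Fin 1 ↪ ι := ⟨fun _ => a, fun _ _ _ => Subsingleton.elim _ _⟩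

theorem wire_apply {ι : Type*} (a : ι) (i : Fin 1) : wire a i = a := rfl

theorem extend_wire (a : ι) (y : Fin 1 → Bool) (x : ι → Bool) :
    Function.extend (wire a) y x = Function.update x a (y 0) := by
  funext w
  by_cases hw : w = a
  · subst hw
    rw [Function.update_self]
    exact (wire w).injective.extend_apply y x 0
  · rw [Function.update_of_ne hw, Function.extend_apply']
    rintro ⟨i, hi⟩
    exact hw hi.symm

/-- The Hadamard gate. -/
noncomputable def hadamard (a : ι) : Gate ι where
  arity := 1
  arity_le := by norm_num
  wires := wire a
  mat := ⟨hadamardMatrix, hadamardMatrix_mem⟩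

theorem hadamard_apply (a : ι) (ψ : QVec ι) (x : ι → Bool) :
    (hadamard a).apply ψ x = ((√2)⁻¹ : ℝ) * (ψ (Function.update x a false) +
      (if x a = true then -1 else 1) * ψ (Function.update x a true)) := by
  have : (hadamard a).apply ψ x = applyOn (wire a) hadamardMatrix ψ x := rfl
  rw [this]
  simp [applyOn, sum_fin_one_bool, extend_wire, hadamardMatrix, wire_apply, mul_add, mul_assoc]

/-- Bit flip. -/
def notGate (a : ι) : Gate ι where
  arity := 1
  arity_le := by norm_num
  wires := wire a
  mat := ⟨permMatrix fun y i => !y i, permMatrix_mem fun y z h => by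
    funext i; simpa using congrFun h i⟩

theorem notGate_apply (a : ι) (ψ : QVec ι) (x : ι → Bool) :
    (notGate a).apply ψ x = ψ (Function.update x a (!x a)) := by
  have : (notGate a).apply ψ x = applyOn (wire a) (permMatrix fun y i => !y i) ψ x := rfl
  rw [this, applyOn_permMatrix]
  simp [extend_wire, wire_apply]

/-- Controlled swap of two bits. -/
def cswapFun (y : Fin 3 → Bool) : Fin 3 → Bool :=
  if y 0 = true then y ∘ Equiv.swap 1 2 else y

theorem cswapFun_injective : Function.Injective cswapFun := by
  have h : Function.Involutive cswapFun := by
    intro y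
    by_cases hy : y 0 = true
    · have h0 : Equiv.swap (1 : Fin 3) 2 0 = 0 := by decide
      funext i
      simp [cswapFun, hy, h0]
    · simp [cswapFun, hy]
  exact h.injective

/-- The controlled swap of the wires `b` and `c` with control `a`. -/
def cswap (a b c : ι) (hab : a ≠ b) (hac : a ≠ c) (hbc : b ≠ c) : Gate ι where
  arity := 3
  arity_le := le_rfl
  wires := ⟨![a, b, c], by
    intro i j
    fin_cases i <;> fin_cases j <;> simp [hab, hac, hbc, hab.symm, hac.symm, hbc.symm]⟩
  mat := ⟨permMatrix cswapFun, permMatrix_mem cswapFun_injective⟩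

theorem cswap_apply (a b c : ι) (hab : a ≠ b) (hac : a ≠ c) (hbc : b ≠ c) (ψ : QVec ι)
    (x : ι → Bool) : (cswap a b c hab hac hbc).apply ψ x =
      ψ (if x a = true then x ∘ Equiv.swap b c else x) := by
  set e : Fin 3 ↪ ι := (cswap a b c hab hac hbc).wires
  have : (cswap a b c hab hac hbc).apply ψ x = applyOn e (permMatrix cswapFun) ψ x := rfl
  rw [this, applyOn_permMatrix]
  change ψ (Function.extend e (cswapFun (x ∘ e)) x) = _
  have e0 : e 0 = a := rfl
  have e1 : e 1 = b := rfl
  have e2 : e 2 = c := rfl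
  have s0 : Equiv.swap (1 : Fin 3) 2 0 = 0 := by decide
  congr 1
  by_cases hx : x a = true
  · rw [if_pos hx]
    have : cswapFun (x ∘ e) = (x ∘ e) ∘ Equiv.swap 1 2 := if_pos hx
    rw [this]
    funext w
    by_cases hw : ∃ i, e i = w
    · obtain ⟨i, rfl⟩ := hw
      rw [e.injective.extend_apply]
      fin_cases i
      · simp [s0, e0, Equiv.swap_apply_of_ne_of_ne hab hac]
      · simp [e1, e2]
      · simp [e1, e2]
    · rw [Function.extend_apply' _ _ _ hw]
      have hb : w ≠ b := fun h => hw ⟨1, h.symm⟩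
      have hc : w ≠ c := fun h => hw ⟨2, h.symm⟩
      simp [Equiv.swap_apply_of_ne_of_ne hb hc]
  · rw [if_neg hx]
    have : cswapFun (x ∘ e) = x ∘ e := if_neg hx
    rw [this, extend_self]

variable {n : ℕ}

/-- A control wire and two disjoint registers to be compared. -/
structure SwapWires (n : ℕ) (ι : Type*) where
  ctl : ι
  fst : Fin n ↪ ι
  snd : Fin n ↪ ι
  ctl_ne_fst : ∀ i, ctl ≠ fst i
  ctl_ne_snd : ∀ i, ctl ≠ snd i
  fst_ne_snd : ∀ i j, fst i ≠ snd j

namespace SwapWires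

variable (w : SwapWires n ι)

/-- Permutation of the wires that exchanges the qubits `l` of the two registers. -/
def perm : List (Fin n) → Equiv.Perm ι
  | [] => 1
  | i :: l => perm l * Equiv.swap (w.fst i) (w.snd i)

theorem perm_of_ne {l : List (Fin n)} {z : ι} (h1 : ∀ i ∈ l, z ≠ w.fst i)
    (h2 : ∀ i ∈ l, z ≠ w.snd i) : w.perm l z = z := by
  induction l with
  | nil => rfl
  | cons i l ih =>
    rw [perm, Equiv.Perm.mul_apply, Equiv.swap_apply_of_ne_of_ne (h1 i (by simp)) (h2 i (by simp))]
    exact ih (fun j hj => h1 j (by simp [hj])) fun j hj => h2 j (by simp [hj])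

theorem perm_fst {l : List (Fin n)} (hl : l.Nodup) {i : Fin n} (hi : i ∈ l) :
    w.perm l (w.fst i) = w.snd i := by
  induction l with
  | nil => simp at hi
  | cons j l ih =>
    rw [List.nodup_cons] at hl
    rw [perm, Equiv.Perm.mul_apply]
    by_cases hij : i = j
    · subst hij
      rw [Equiv.swap_apply_left, w.perm_of_ne]
      · exact fun k _ h => w.fst_ne_snd k i h.symm
      · intro k hk h
        rw [w.snd.injective h] at hl
        exact hl.1 hk
    · rw [Equiv.swap_apply_of_ne_of_ne (fun h => hij (w.fst.injective h)) (w.fst_ne_snd _ _)]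
      exact ih hl.2 ((List.mem_cons.mp hi).resolve_left hij)

theorem perm_snd {l : List (Fin n)} (hl : l.Nodup) {i : Fin n} (hi : i ∈ l) :
    w.perm l (w.snd i) = w.fst i := by
  induction l with
  | nil => simp at hi
  | cons j l ih =>
    rw [List.nodup_cons] at hl
    rw [perm, Equiv.Perm.mul_apply]
    by_cases hij : i = j
    · subst hij
      rw [Equiv.swap_apply_right, w.perm_of_ne]
      · intro k hk h
        rw [w.fst.injective h] at hl
        exact hl.1 hk
      · exact fun k _ h => w.fst_ne_snd i k h
    · rw [Equiv.swap_apply_of_ne_of_ne (fun h => w.fst_ne_snd _ _ h.symm)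
        (fun h => hij (w.snd.injective h))]
      exact ih hl.2 ((List.mem_cons.mp hi).resolve_left hij)

theorem perm_ctl (l : List (Fin n)) : w.perm l w.ctl = w.ctl :=
  w.perm_of_ne (fun i _ => w.ctl_ne_fst i) fun i _ => w.ctl_ne_snd i

/-- Controlled exchange of the qubits `l` of the two registers. -/
def cswaps (l : List (Fin n)) : Circuit ι :=
  List.map (fun i => cswap w.ctl (w.fst i) (w.snd i) (w.ctl_ne_fst i) (w.ctl_ne_snd i)
    (w.fst_ne_snd i i)) l

theorem run_cswaps (l : List (Fin n)) (ψ : QVec ι) (x : ι → Bool) :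
    (w.cswaps l).run ψ x = ψ (if x w.ctl = true then x ∘ w.perm l else x) := by
  induction l generalizing ψ with
  | nil => simp [cswaps, Circuit.run, perm]
  | cons i l ih =>
    change Circuit.run (w.cswaps l) (Gate.apply _ ψ) x = _
    rw [ih, cswap_apply]
    by_cases hx : x w.ctl = true
    · simp only [hx, if_true, Function.comp_apply, perm_ctl]
      rfl
    · simp [hx]

/-- Permutation of the wires that exchanges the two registers. -/
def swap : Equiv.Perm ι := w.perm (List.finRange n)

theorem swap_fst (i : Fin n) : w.swap (w.fst i) = w.snd i :=
  w.perm_fst (List.nodup_finRange n) (List.mem_finRange i)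

theorem swap_snd (i : Fin n) : w.swap (w.snd i) = w.fst i :=
  w.perm_snd (List.nodup_finRange n) (List.mem_finRange i)

theorem swap_of_ne {z : ι} (h1 : ∀ i, z ≠ w.fst i) (h2 : ∀ i, z ≠ w.snd i) : w.swap z = z :=
  w.perm_of_ne (fun i _ => h1 i) fun i _ => h2 i

theorem swap_ctl : w.swap w.ctl = w.ctl := w.perm_ctl _

/-- The swap test; its result is the control qubit. -/
noncomputable def test : Circuit ι :=
  hadamard w.ctl :: (w.cswaps (List.finRange n) ++ [hadamard w.ctl])

theorem length_test {ι : Type*} (w : SwapWires n ι) : w.test.length = n + 2 := by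
  simp [test, cswaps]

/-- Where the control is 1, the sign of the second Hadamard gate turns the superposition of the
unswapped and the swapped state into their difference. -/
theorem run_test_apply {ψ : QVec ι} (hψ : ∀ x, x w.ctl = true → ψ x = 0) {x : ι → Bool}
    (hx : x w.ctl = true) :
    w.test.run ψ x = 1 / 2 * (ψ (Function.update x w.ctl false) -
      ψ (Function.update x w.ctl false ∘ w.swap)) := by
  have h1 : ∀ x, ψ (Function.update x w.ctl true) = 0 := fun x => hψ _ (by simp)
  have h2 : Function.update (Function.update x w.ctl true ∘ w.perm (List.finRange n)) w.ctl false
      = Function.update x w.ctl false ∘ w.swap := by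
    funext z
    by_cases hz : z = w.ctl
    · subst hz
      simp [swap_ctl]
    · have : w.swap z ≠ w.ctl := fun h => hz (w.swap.injective (h.trans w.swap_ctl.symm))
      have h' : w.perm (List.finRange n) z = w.swap z := rfl
      simp [hz, h', this]
  rw [test, Circuit.run_cons, Circuit.run_append, Circuit.run_cons, Circuit.run_nil,
    hadamard_apply, run_cswaps, run_cswaps]
  simp only [hadamard_apply, h1, mul_zero, add_zero, Function.update_self, hx, if_true,
    Bool.false_eq_true, if_false, h2]
  rw [Function.update_idem]
  linear_combination (ψ (Function.update x w.ctl false) -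
    ψ (Function.update x w.ctl false ∘ w.swap)) * sqrt_two_inv_mul_self

variable [Fintype ι]

theorem prOne_test {ψ : QVec ι} (hψ : ∀ x, x w.ctl = true → ψ x = 0) :
    prOne w.ctl (w.test.run ψ) = 1 / 4 * normSq (ψ - fun x => ψ (x ∘ w.swap)) := by
  set g : (ι → Bool) → ℝ := fun x => 1 / 4 * ‖ψ x - ψ (x ∘ w.swap)‖ ^ 2 with hg
  have h1 : prOne w.ctl (w.test.run ψ) =
      ∑ x : ι → Bool, if x w.ctl = true then g (Function.update x w.ctl (!x w.ctl)) else 0 := by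
    refine Finset.sum_congr rfl fun x _ => ?_
    by_cases hx : x w.ctl = true
    · simp only [hx, if_true, w.run_test_apply hψ hx, hg, Bool.not_true]
      rw [norm_mul, mul_pow]
      norm_num
    · simp [hx]
  -- Flipping the control moves the sum to control 0, where `ψ` is supported.
  have hinv : Function.Involutive fun x : ι → Bool => Function.update x w.ctl (!x w.ctl) := by
    intro x; simp
  rw [h1, ← Equiv.sum_comp hinv.toPerm]
  simp only [normSq, Finset.mul_sum]
  refine Finset.sum_congr rfl fun x _ => ?_
  rw [Function.Involutive.coe_toPerm]
  by_cases hx : x w.ctl = true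
  · have h2 : (x ∘ w.swap) w.ctl = true := by simp [swap_ctl, hx]
    simp [hx, hψ x hx, hψ _ h2]
  · rw [Bool.not_eq_true] at hx
    have h3 : Function.update x w.ctl false = x := by rw [← hx, Function.update_eq_self]
    simp [hx, hg, h3]

/-- Let $P,P'$ project the first and the second register onto $r$, and let $S$ exchange the
registers. Then $P'\psi=\psi$ and $PS\psi=S\psi$, so $\langle\psi,S\psi\rangle=\langle
P'P\psi,S\psi\rangle=\langle P\psi,SP\psi\rangle$. Finally $S$ fixes $P\psi$, which has $r$ in both
registers. -/
theorem ip_swap {r : QVec (Fin n)} (hr : normSq r = 1) {h : QVec ι} (hh : IndepOf w.snd h)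
    {ψ : QVec ι} (hψ : ψ = fun x => r (x ∘ w.snd) * h x) :
    ip ψ (fun x => ψ (x ∘ w.swap)) = normSq (applyOn w.fst (proj r) ψ) := by
  have he : w.fst = w.snd.trans w.swap.toEmbedding := by
    ext i; exact (w.swap_snd i).symm
  have hf : w.snd = w.fst.trans w.swap.toEmbedding := by
    ext i; exact (w.swap_fst i).symm
  have p1 : applyOn w.snd (proj r) ψ = ψ := by
    rw [hψ, applyOn_proj_of_eq _ hr hh]
  have p2 : applyOn w.fst (proj r) (fun x => ψ (x ∘ w.swap)) = fun x => ψ (x ∘ w.swap) := by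
    conv_lhs => rw [he]
    rw [applyOn_perm, p1]
  have p3 : applyOn w.snd (proj r) (fun x => ψ (x ∘ w.swap)) =
      fun x => applyOn w.fst (proj r) ψ (x ∘ w.swap) := by
    conv_lhs => rw [hf]
    rw [applyOn_perm]
  have p4 : (fun x => applyOn w.fst (proj r) ψ (x ∘ w.swap)) = applyOn w.fst (proj r) ψ := by
    have hdis : ∀ i j, w.snd i ≠ w.fst j := fun i j => (w.fst_ne_snd j i).symm
    have hform : ∀ x, applyOn w.fst (proj r) ψ x =
        r (x ∘ w.fst) * (r (x ∘ w.snd) * ip r fun y => h (Function.extend w.fst y x)) := by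
      intro x
      rw [applyOn_proj_apply, hψ]
      simp only [extend_comp_of_disjoint w.fst w.snd w.fst_ne_snd]
      congr 1
      exact ip_smul_right _ r _
    funext x
    have hx1 : (x ∘ w.swap) ∘ w.fst = x ∘ w.snd := by
      funext i; simp [swap_fst]
    have hx2 : (x ∘ w.swap) ∘ w.snd = x ∘ w.fst := by
      funext i; simp [swap_snd]
    -- The first register is overwritten by `y` and `h` ignores the second, so the exchange of the
    -- two cannot be seen.
    have hx3 : ∀ y, h (Function.extend w.fst y (x ∘ w.swap)) = h (Function.extend w.fst y x) := by
      intro y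
      rw [← hh (x ∘ w.fst) (Function.extend w.fst y x)]
      congr 1
      funext z
      by_cases hz : ∃ i, w.fst i = z
      · obtain ⟨i, rfl⟩ := hz
        rw [w.fst.injective.extend_apply, Function.extend_apply', w.fst.injective.extend_apply]
        rintro ⟨j, hj⟩
        exact hdis j i hj
      · rw [Function.extend_apply' _ _ _ hz]
        by_cases hz' : ∃ i, w.snd i = z
        · obtain ⟨i, rfl⟩ := hz'
          rw [w.snd.injective.extend_apply]
          simp [swap_snd]
        · rw [Function.extend_apply' _ _ _ hz', Function.extend_apply' _ _ _ hz]
          push Not at hz hz'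
          simp [w.swap_of_ne (fun i => (hz i).symm) fun i => (hz' i).symm]
    rw [hform, hform, hx1, hx2]
    simp only [hx3]
    ring
  calc ip ψ (fun x => ψ (x ∘ w.swap))
      = ip (applyOn w.fst (proj r) (applyOn w.snd (proj r) ψ)) (fun x => ψ (x ∘ w.swap)) := by
        rw [p1, ← ip_applyOn_proj, p2]
    _ = normSq (applyOn w.fst (proj r) ψ) := by
        rw [applyOn_comm _ _ w.fst_ne_snd, ← ip_applyOn_proj, p3, p4, ip_self]

/-- Probability that the swap test of a state with `r` in the second register fails. -/
theorem prOne_test_eq {r : QVec (Fin n)} (hr : normSq r = 1) {h : QVec ι} (hh : IndepOf w.snd h)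
    {ψ : QVec ι} (hψ : ψ = fun x => r (x ∘ w.snd) * h x) (h0 : ∀ x, x w.ctl = true → ψ x = 0)
    (h1 : normSq ψ = 1) :
    prOne w.ctl (w.test.run ψ) = (1 - normSq (applyOn w.fst (proj r) ψ)) / 2 := by
  have h2 : normSq (fun x => ψ (x ∘ w.swap)) = normSq ψ :=
    (Equiv.arrowCongr w.swap.symm (Equiv.refl Bool)).sum_comp fun x => ‖ψ x‖ ^ 2
  rw [w.prOne_test h0, normSq_sub, h2, h1, w.ip_swap hr hh hψ, Complex.ofReal_re]
  ring

end SwapWires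

end SwapTest

/-! ## Averages -/

section Average

variable {K L : Type*} [Fintype K] [Fintype L]

theorem uniformAvg_mono {f g : K → ℝ} (h : ∀ k, f k ≤ g k) : uniformAvg f ≤ uniformAvg g :=
  div_le_div_of_nonneg_right (Finset.sum_le_sum fun k _ => h k) (Nat.cast_nonneg _)

theorem uniformAvg_nonneg {f : K → ℝ} (h : ∀ k, 0 ≤ f k) : 0 ≤ uniformAvg f :=
  div_nonneg (Finset.sum_nonneg fun k _ => h k) (Nat.cast_nonneg _)

theorem uniformAvg_const [Nonempty K] (a : ℝ) : uniformAvg (fun _ : K => a) = a := by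
  simp [uniformAvg]

theorem uniformAvg_const_le {a : ℝ} (ha : 0 ≤ a) : uniformAvg (fun _ : K => a) ≤ a := by
  rcases isEmpty_or_nonempty K with h | h
  · simpa [uniformAvg] using ha
  · rw [uniformAvg_const]

theorem uniformAvg_add (f g : K → ℝ) :
    uniformAvg (fun k => f k + g k) = uniformAvg f + uniformAvg g := by
  simp [uniformAvg, Finset.sum_add_distrib, add_div]

theorem uniformAvg_sub (f g : K → ℝ) :
    uniformAvg (fun k => f k - g k) = uniformAvg f - uniformAvg g := by
  simp [uniformAvg, Finset.sum_sub_distrib, sub_div]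

theorem uniformAvg_mul_left (a : ℝ) (f : K → ℝ) :
    uniformAvg (fun k => a * f k) = a * uniformAvg f := by
  simp [uniformAvg, ← Finset.mul_sum, mul_div_assoc]

theorem uniformAvg_sum {α : Type*} (s : Finset α) (f : α → K → ℝ) :
    uniformAvg (fun k => ∑ a ∈ s, f a k) = ∑ a ∈ s, uniformAvg (f a) := by
  simp only [uniformAvg, ← Finset.sum_div]
  rw [Finset.sum_comm]

theorem uniformAvg_comm (f : K → L → ℝ) :
    uniformAvg (fun k => uniformAvg fun l => f k l) =
      uniformAvg fun l => uniformAvg fun k => f k l := by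
  simp only [uniformAvg, ← Finset.sum_div]
  rw [Finset.sum_comm, div_div, div_div, mul_comm]

theorem uniformAvg_list_sum {α : Type*} (l : List α) (f : α → K → ℝ) :
    uniformAvg (fun k => (l.map fun a => f a k).sum) = (l.map fun a => uniformAvg (f a)).sum := by
  induction l with
  | nil => simp [uniformAvg]
  | cons a l ih => simp only [List.map_cons, List.sum_cons, uniformAvg_add, ih]

end Average

/-! ## Bases and projections -/

section Basis

variable {ι κ : Type*} [Fintype ι] [DecidableEq ι] [Fintype κ] [DecidableEq κ]

theorem applyU_mul (U V : QUnitary κ) (φ : QVec κ) :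
    applyU (U * V) φ = applyU U (applyU V φ) := by
  simp [applyU, Matrix.mulVec_mulVec]

/-- The vector is completed to an orthonormal basis, whose elements become the columns of `Q`. -/
theorem exists_applyU_zeroState {φ : QVec κ} (hφ : normSq φ = 1) :
    ∃ Q : QUnitary κ, applyU Q (zeroState κ) = φ := by
  let v : (κ → Bool) → EuclideanSpace ℂ (κ → Bool) := fun _ => WithLp.toLp 2 φ
  have hv : Orthonormal ℂ (Set.domRestrict {fun _ => false} v) := by
    constructor
    · intro i
      have : nrm φ = 1 := by
        have := nrm_sq φ
        rw [hφ] at this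
        exact (pow_eq_one_iff_of_nonneg (nrm_nonneg _) two_ne_zero).mp this
      exact this
    · intro i j hij
      exact absurd (Subsingleton.elim i j) hij
  obtain ⟨b, hb⟩ := hv.exists_orthonormalBasis_extension_of_card_eq (by simp)
  have h0 : b (fun _ => false) = WithLp.toLp 2 φ := hb _ rfl
  refine ⟨⟨_, (EuclideanSpace.basisFun (κ → Bool) ℂ).toMatrix_orthonormalBasis_mem_unitary b⟩, ?_⟩
  funext x
  simp [applyU, Matrix.mulVec, dotProduct, zeroState, basisState, Module.Basis.toMatrix_apply, h0]

theorem proj_applyU (U : QUnitary κ) (r : QVec κ) :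
    proj (applyU U r) = (U : Matrix _ _ ℂ) * proj r * (U : Matrix _ _ ℂ).conjTranspose := by
  rw [proj, proj, applyU, Matrix.star_mulVec, ← Matrix.vecMulVec_mul, ← Matrix.mul_vecMulVec]

theorem sum_proj_basisState : ∑ j : κ → Bool, proj (basisState j) = 1 := by
  ext x y
  simp only [Matrix.sum_apply, proj, Matrix.vecMulVec_apply, basisState, Pi.star_apply,
    Matrix.one_apply]
  simp [apply_ite, eq_comm]

theorem sum_proj_applyU (U : QUnitary κ) : ∑ j, proj (applyU U (basisState j)) = 1 := by
  simp only [proj_applyU]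
  rw [← Finset.sum_mul, ← Finset.mul_sum, sum_proj_basisState, mul_one]
  exact Matrix.mem_unitaryGroup_iff.mp U.2

/-- A complete measurement in the basis of the columns of `U`. Averaged over `j`, it says that a
random basis vector is found with probability $2^{-|\kappa|}$, whatever the state. -/
theorem sum_normSq_proj (e : κ ↪ ι) (U : QUnitary κ) (ψ : QVec ι) :
    ∑ j, normSq (applyOn e (proj (applyU U (basisState j))) ψ) = normSq ψ := by
  have h : ∀ j, normSq (applyU U (basisState j)) = 1 := fun j => by
    rw [normSq_applyU, normSq_basisState]
  simp only [normSq_proj e (h _)]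
  rw [← Complex.re_sum, ← ip_sum_right, ← applyOn_matrix_sum, sum_proj_applyU, applyOn_one,
    normSq_eq_re_ip]

/-- In the basis given by the columns of `Q`, exchange the vectors `0` and `j`. -/
noncomputable def exchange (Q : QUnitary κ) (j : κ → Bool) : QUnitary κ :=
  Q * ⟨permMatrix (Equiv.swap (fun _ => false) j), permMatrix_mem (Equiv.injective _)⟩ * Q⁻¹

theorem applyU_exchange (Q : QUnitary κ) (j : κ → Bool) :
    applyU (exchange Q j) (applyU Q (zeroState κ)) = applyU Q (basisState j) := by
  rw [exchange, ← applyU_mul, inv_mul_cancel_right, applyU_mul]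
  congr 1
  funext x
  simp only [applyU, Matrix.mulVec, dotProduct, permMatrix, zeroState, basisState]
  have : (fun _ => false : κ → Bool) = Equiv.swap (fun _ => false) j x ↔ x = j := by
    rw [eq_comm, ← Equiv.eq_symm_apply, Equiv.symm_swap, Equiv.swap_apply_left]
  simp [this]

/-- The exchange is the identity on the orthogonal complement of the two vectors, so a query notices
it only through the components of its input along them. -/
theorem exchange_sub_one (Q : QUnitary κ) (j : κ → Bool) :
    (exchange Q j : Matrix (κ → Bool) (κ → Bool) ℂ) - 1 = ((exchange Q j : Matrix _ _ ℂ) - 1) *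
      (proj (applyU Q (zeroState κ)) + proj (applyU Q (basisState j))) := by
  have hQ : (Q : Matrix (κ → Bool) (κ → Bool) ℂ) * (Q : Matrix _ _ ℂ).conjTranspose = 1 :=
    Matrix.mem_unitaryGroup_iff.mp Q.2
  have hQ' : (Q : Matrix (κ → Bool) (κ → Bool) ℂ).conjTranspose * Q = 1 :=
    Matrix.mem_unitaryGroup_iff'.mp Q.2
  set P : Matrix (κ → Bool) (κ → Bool) ℂ := permMatrix (Equiv.swap (fun _ => false) j) with hP
  have hW : (exchange Q j : Matrix (κ → Bool) (κ → Bool) ℂ) =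
      (Q : Matrix (κ → Bool) (κ → Bool) ℂ) * P * (Q : Matrix _ _ ℂ).conjTranspose := rfl
  have key : P - 1 = (P - 1) * (proj (zeroState κ) + proj (basisState j)) := by
    -- If the two vectors coincide, the sum of the projections is twice a projection, but then both
    -- sides vanish.
    by_cases hj : j = fun _ => false
    · have : P = 1 := by
        ext x y
        simp [hP, hj, permMatrix, Matrix.one_apply, eq_comm]
      rw [this]; simp
    · ext x y
      have h1 : (P * (proj (zeroState κ) + proj (basisState j))) x y =
          P x y * ((if y = fun _ => false then 1 else 0) + if y = j then 1 else 0) := by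
        simp only [Matrix.mul_apply, Matrix.add_apply, proj, Matrix.vecMulVec_apply, zeroState,
          basisState, Pi.star_apply, mul_add, Finset.sum_add_distrib]
        congr 1 <;>
        · simp only [ite_mul, one_mul, zero_mul, mul_ite, mul_zero, apply_ite star,
            star_one, star_zero]
          split_ifs with h
          · rw [h]; simp
          · simp
      have h2 : ((1 : Matrix (κ → Bool) (κ → Bool) ℂ) *
          (proj (zeroState κ) + proj (basisState j))) x y =
          (1 : Matrix (κ → Bool) (κ → Bool) ℂ) x y *
          ((if y = fun _ => false then 1 else 0) + if y = j then 1 else 0) := by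
        rw [one_mul]
        simp only [Matrix.add_apply, proj, Matrix.vecMulVec_apply, zeroState, basisState,
          Pi.star_apply, Matrix.one_apply, apply_ite star, star_one, star_zero]
        split_ifs <;> simp_all
      rw [sub_mul, Matrix.sub_apply, Matrix.sub_apply, h1, h2, ← sub_mul]
      by_cases hy : y = fun _ => false
      · have : y ≠ j := fun h => hj (h.symm.trans hy)
        rw [if_pos hy, if_neg this]; simp
      · by_cases hy' : y = j
        · simp [hy', hj]
        · have : Equiv.swap (fun _ => false) j y = y := Equiv.swap_apply_of_ne_of_ne hy hy'
          have h3 : y = Equiv.swap (fun _ => false) j x ↔ x = y := by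
            rw [eq_comm, ← Equiv.eq_symm_apply, Equiv.symm_swap, this]
          simp [hy, hy', hP, permMatrix, Matrix.one_apply, h3]
  have hW1 : (exchange Q j : Matrix (κ → Bool) (κ → Bool) ℂ) - 1 =
      (Q : Matrix (κ → Bool) (κ → Bool) ℂ) * (P - 1) * (Q : Matrix _ _ ℂ).conjTranspose := by
    rw [hW, mul_sub, sub_mul, mul_one, hQ]
  rw [hW1, proj_applyU, proj_applyU, ← add_mul, ← mul_add]
  conv_lhs => rw [key]
  simp only [Matrix.mul_assoc]
  rw [← Matrix.mul_assoc _ (Q : Matrix (κ → Bool) (κ → Bool) ℂ) (_ * _), hQ', Matrix.one_mul]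

/-- The 8 is $4\cdot2$: $\|W-1\|\le2$ for a unitary $W$, and the squared norm of a sum of two
vectors is at most twice the sum of the squares. -/
theorem normSq_exchange_sub_one_le (e : κ ↪ ι) (Q : QUnitary κ) (j : κ → Bool) (ξ : QVec ι) :
    normSq (applyOn e ((exchange Q j : Matrix _ _ ℂ) - 1) ξ) ≤
      8 * normSq (applyOn e (proj (applyU Q (zeroState κ))) ξ) +
        8 * normSq (applyOn e (proj (applyU Q (basisState j))) ξ) := by
  rw [exchange_sub_one, applyOn_mul, applyOn_matrix_sub, applyOn_one, applyOn_matrix_add]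
  set η := applyOn e (proj (applyU Q (zeroState κ))) ξ + applyOn e (proj (applyU Q (basisState j))) ξ
    with hη
  have h1 : normSq η ≤ _ := normSq_add_le _ _
  have h2 := nrm_sub_le (applyOn e (exchange Q j : Matrix _ _ ℂ) η) η
  rw [nrm_of_normSq_eq (normSq_applyOn_unitary e (exchange Q j) η)] at h2
  have h3 : normSq (applyOn e (exchange Q j : Matrix _ _ ℂ) η - η) ≤ 4 * normSq η := by
    rw [← nrm_sq, ← nrm_sq]
    nlinarith [nrm_nonneg (applyOn e (exchange Q j : Matrix _ _ ℂ) η - η), nrm_nonneg η]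
  linarith

end Basis

/-! ## Random states with small overlaps -/

section Overlap

variable {ι κ K : Type*} [Fintype ι] [DecidableEq ι] [Fintype κ] [DecidableEq κ] [Fintype K]

/-- Mean squared overlap of two independent random states of an ensemble. -/
noncomputable def meanOverlap (φ : K → QVec κ) : ℝ :=
  uniformAvg fun k => uniformAvg fun l => ‖ip (φ k) (φ l)‖ ^ 2

/-- The squared Frobenius norm of $S=\sum_kP_k$ is $\mathrm{tr}(S^*S)$, and
$\mathrm{tr}(P_kP_l)=|\langle\phi_k,\phi_l\rangle|^2$. -/
theorem sum_norm_sq_sum_proj (φ : K → QVec κ) :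
    ∑ y, ∑ z, ‖(∑ k, proj (φ k)) y z‖ ^ 2 = ∑ k, ∑ l, ‖ip (φ k) (φ l)‖ ^ 2 := by
  have key : (∑ y, ∑ z, star ((∑ k, proj (φ k)) y z) * (∑ k, proj (φ k)) y z) =
      ∑ k, ∑ l, star (ip (φ k) (φ l)) * ip (φ k) (φ l) := by
    simp only [Matrix.sum_apply, star_sum, Finset.sum_mul_sum, proj, Matrix.vecMulVec_apply,
      Pi.star_apply, star_mul', star_star, ip]
    have : ∀ (F : (κ → Bool) → (κ → Bool) → K → K → ℂ),
        ∑ y, ∑ z, ∑ k, ∑ l, F y z k l = ∑ k, ∑ l, ∑ z, ∑ y, F y z k l := by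
      intro F
      calc ∑ y, ∑ z, ∑ k, ∑ l, F y z k l = ∑ p : (κ → Bool) × (κ → Bool), ∑ q : K × K,
            F p.1 p.2 q.1 q.2 := by simp only [Fintype.sum_prod_type]
        _ = ∑ q : K × K, ∑ p : (κ → Bool) × (κ → Bool), F p.1 p.2 q.1 q.2 := Finset.sum_comm
        _ = _ := by
          simp only [Fintype.sum_prod_type]
          exact Finset.sum_congr rfl fun _ _ => Finset.sum_congr rfl fun _ _ => Finset.sum_comm
    rw [this]
    exact Finset.sum_congr rfl fun _ _ => Finset.sum_congr rfl fun _ _ =>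
      Finset.sum_congr rfl fun _ _ => Finset.sum_congr rfl fun _ _ => by ring
  have hn : ∀ a : ℂ, star a * a = ((‖a‖ ^ 2 : ℝ) : ℂ) := fun a => by
    rw [Complex.ofReal_pow, ← Complex.conj_mul']; rfl
  simp only [hn] at key
  exact_mod_cast key

/-- On average, a fixed state has small overlap with a random state of the ensemble. -/
theorem uniformAvg_normSq_proj_le {φ : K → QVec κ} (hφ : ∀ k, normSq (φ k) = 1) (e : κ ↪ ι)
    {ξ : QVec ι} (hξ : normSq ξ = 1) :
    uniformAvg (fun k => normSq (applyOn e (proj (φ k)) ξ)) ≤ √(meanOverlap φ) := by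
  have h1 : ∑ k, normSq (applyOn e (proj (φ k)) ξ) =
      (ip ξ (applyOn e (∑ k, proj (φ k)) ξ)).re := by
    simp only [normSq_proj e (hφ _)]
    rw [← Complex.re_sum, ← ip_sum_right, ← applyOn_matrix_sum]
  -- $\langle\xi,S\xi\rangle\le\|S\xi\|$ for the sum $S$ of the projections, and $\|S\xi\|$ is at
  -- most the Frobenius norm of $S$, even if $\xi$ lives on a larger register.
  have h2 : ∑ k, normSq (applyOn e (proj (φ k)) ξ) ≤ √(∑ k, ∑ l, ‖ip (φ k) (φ l)‖ ^ 2) := by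
    rw [h1]
    have hξ1 : nrm ξ = 1 := by
      have := nrm_sq ξ
      rw [hξ] at this
      exact (pow_eq_one_iff_of_nonneg (nrm_nonneg _) two_ne_zero).mp this
    refine ((Complex.re_le_norm _).trans (norm_ip_le _ _)).trans ?_
    rw [hξ1, one_mul]
    refine Real.le_sqrt_of_sq_le ?_
    rw [nrm_sq, ← sum_norm_sq_sum_proj]
    simpa [hξ] using normSq_applyOn_le e (∑ k, proj (φ k)) ξ
  have h3 : meanOverlap φ = (∑ k, ∑ l, ‖ip (φ k) (φ l)‖ ^ 2) / (Fintype.card K : ℝ) ^ 2 := by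
    simp only [meanOverlap, uniformAvg, ← Finset.sum_div, div_div, sq]
  rw [h3, Real.sqrt_div' _ (by positivity), Real.sqrt_sq (Nat.cast_nonneg _)]
  exact div_le_div_of_nonneg_right h2 (Nat.cast_nonneg _)

end Overlap

/-! ## Haar measure on the unitary group -/

section Haar

variable {n : ℕ}

instance isHaarMeasure_haarUnitary (n : ℕ) : (haarUnitary n).IsHaarMeasure := by
  unfold haarUnitary; infer_instance

instance isProbabilityMeasure_haarUnitary (n : ℕ) : IsProbabilityMeasure (haarUnitary n) :=
  ⟨by simpa [haarUnitary] using Measure.haarMeasure_self (K₀ := (⊤ : TopologicalSpace.PositiveCompacts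
    (QUnitary (Fin n))))⟩

/-- A right translate is again a Haar measure of total mass 1, and such a measure is unique.
Invariance from the right is the one needed, since the oracle is changed on its inputs. -/
instance isMulRightInvariant_haarUnitary (n : ℕ) : (haarUnitary n).IsMulRightInvariant := by
  constructor
  intro g
  have : IsProbabilityMeasure ((haarUnitary n).map (· * g)) :=
    Measure.isProbabilityMeasure_map (measurable_mul_const g).aemeasurable
  have h2 : ((haarUnitary n).map (· * g)).IsHaarMeasure := Measure.isHaarMeasure_map_mul_right _ g
  exact Measure.isHaarMeasure_eq_of_isProbabilityMeasure _ _

theorem integrable_haarUnitary {f : QUnitary (Fin n) → ℝ} (hf : Continuous f) :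
    Integrable f (haarUnitary n) :=
  hf.integrable_of_hasCompactSupport (HasCompactSupport.of_compactSpace f)

theorem integral_uniformAvg {K : Type*} [Fintype K] {f : K → QUnitary (Fin n) → ℝ}
    (hf : ∀ k, Continuous (f k)) :
    ∫ V, uniformAvg (fun k => f k V) ∂(haarUnitary n) =
      uniformAvg fun k => ∫ V, f k V ∂(haarUnitary n) := by
  simp only [uniformAvg]
  rw [integral_div, integral_finsetSum _ fun k _ => integrable_haarUnitary (hf k)]

theorem continuous_uniformAvg {X K : Type*} [TopologicalSpace X] [Fintype K] {f : K → X → ℝ}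
    (hf : ∀ k, Continuous (f k)) : Continuous fun x => uniformAvg fun k => f k x :=
  (continuous_finsetSum _ fun k _ => hf k).div_const _

/-- Averaging over finitely many right translations does not change a Haar integral. -/
theorem integral_eq_integral_uniformAvg_mul {K : Type*} [Fintype K] [Nonempty K]
    {f : QUnitary (Fin n) → ℝ} (hf : Continuous f) (W : K → QUnitary (Fin n)) :
    ∫ V, f V ∂(haarUnitary n) = ∫ V, uniformAvg (fun k => f (V * W k)) ∂(haarUnitary n) := by
  rw [integral_uniformAvg (f := fun k V => f (V * W k))
    fun k => hf.comp (continuous_mul_const (W k))]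
  simp only [integral_mul_right_eq_self f]
  rw [uniformAvg_const]

theorem continuous_normSq {X ι : Type*} [TopologicalSpace X] [Fintype ι] [DecidableEq ι]
    {ψ : X → QVec ι} (hψ : Continuous ψ) : Continuous fun a => normSq (ψ a) := by
  have : ∀ x, Continuous fun a => ψ a x := fun x => (continuous_apply x).comp hψ
  exact continuous_finsetSum _ fun x _ => (this x).norm.pow 2

theorem continuous_applyU (φ : QVec (Fin n)) : Continuous fun U : QUnitary (Fin n) => applyU U φ :=
  continuous_subtype_val.matrix_mulVec continuous_const

theorem continuous_applyOn {X ι κ : Type*} [TopologicalSpace X] [Fintype κ] [DecidableEq κ]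
    (e : κ ↪ ι) {G : X → Matrix (κ → Bool) (κ → Bool) ℂ} (hG : Continuous G) {ψ : X → QVec ι}
    (hψ : Continuous ψ) : Continuous fun a => applyOn e (G a) (ψ a) := by
  have hψ' : ∀ x, Continuous fun a => ψ a x := fun x => (continuous_apply x).comp hψ
  exact continuous_pi fun x => continuous_finsetSum _ fun y _ =>
    (hG.matrix_elem _ _).mul (hψ' _)

theorem normSq_proj_refl {κ : Type*} [Fintype κ] [DecidableEq κ] {r : QVec κ} (hr : normSq r = 1)
    (φ : QVec κ) :
    normSq (applyOn (Function.Embedding.refl κ) (proj r) φ) = ‖ip r φ‖ ^ 2 := by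
  have h2 : applyOn (Function.Embedding.refl _) (proj r) φ = ip r φ • r := by
    funext x
    rw [applyOn_proj_apply, mul_comm]
    have : ∀ y : κ → Bool, Function.extend (Function.Embedding.refl κ) y x = y :=
      fun y => extend_comp_self (Function.Embedding.refl κ) y x
    simp only [this]
    rfl
  rw [h2, normSq_smul, hr, mul_one]

/-- Mean squared overlap of a fixed state with a Haar random state. -/
theorem haarStateAvg_overlap {φ : QVec (Fin n)} (hφ : normSq φ = 1) :
    haarStateAvg n (fun ψ => ‖ip φ ψ‖ ^ 2) = (1 / 2) ^ n := by
  have hc : ∀ χ : QVec (Fin n), Continuous fun V : QUnitary (Fin n) => ‖ip φ (applyU V χ)‖ ^ 2 := by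
    intro χ
    have : ∀ x, Continuous fun V : QUnitary (Fin n) => applyU V χ x :=
      fun x => (continuous_apply x).comp (continuous_applyU χ)
    exact (continuous_finsetSum _ fun x _ => continuous_const.mul (this x)).norm.pow 2
  -- By invariance the first column of $V$ may be replaced by a random one, and the squared overlaps
  -- of $\phi$ with all columns add up to 1.
  rw [haarStateAvg, integral_eq_integral_uniformAvg_mul (hc _) fun j => exchange 1 j]
  have h1 : ∀ (V : QUnitary (Fin n)) j, ‖ip φ (applyU (V * exchange 1 j) (zeroState (Fin n)))‖ ^ 2 =
      normSq (applyOn (Function.Embedding.refl _) (proj (applyU V (basisState j))) φ) := by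
    intro V j
    have hone : ∀ χ : QVec (Fin n), applyU 1 χ = χ := fun χ => by simp [applyU]
    have := applyU_exchange (1 : QUnitary (Fin n)) j
    rw [hone, hone] at this
    rw [applyU_mul, this]
    rw [normSq_proj_refl (by rw [normSq_applyU, normSq_basisState]), ← star_ip, norm_star]
  simp only [h1]
  have h2 : ∀ V : QUnitary (Fin n), uniformAvg (fun j => normSq (applyOn (Function.Embedding.refl _)
      (proj (applyU V (basisState j))) φ)) = (1 / 2) ^ n := by
    intro V
    rw [uniformAvg, sum_normSq_proj, hφ]
    simp
  simp only [h2]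
  simp

end Haar

/-! ## Response to a challenge when the device is Haar random -/

section Response

variable {n : ℕ} {T : Type} [Fintype T] [DecidableEq T]

/-- The qubits of the response to challenge `t`. -/
def respWires (w n : ℕ) {T : Type} (t : T) : Fin n ↪ Fin w ⊕ (T × Fin n) :=
  ⟨fun i => Sum.inr (t, i), fun i j h => by simpa using h⟩

/-- Probability that the response to challenge `t` is found in the correct state. -/
noncomputable def Adversary.hit (A : Adversary n T) (t : T) (U : QUnitary (Fin n))
    (c : T → QVec (Fin n)) : ℝ :=
  normSq (applyOn (respWires A.work n t) (proj (applyU U (c t))) (A.output U c))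

theorem normSq_tensorFamily_of_unit {c : T → QVec (Fin n)} (hc : ∀ t, normSq (c t) = 1) :
    normSq (tensorFamily c) = 1 := by
  rw [normSq_tensorFamily]; simp [hc]

theorem Adversary.normSq_output (A : Adversary n T) (U : QUnitary (Fin n)) {c : T → QVec (Fin n)}
    (hc : ∀ t, normSq (c t) = 1) : normSq (A.output U c) = 1 := by
  rw [output, Circuit.normSq_run, normSq_tensor, OracleCircuit.normSq_run, normSq_zeroState,
    normSq_tensorFamily_of_unit hc, one_mul]

theorem Adversary.hit_nonneg (A : Adversary n T) (t : T) (U : QUnitary (Fin n))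
    (c : T → QVec (Fin n)) : 0 ≤ A.hit t U c := normSq_nonneg _

theorem Adversary.hit_le_one (A : Adversary n T) (t : T) (U : QUnitary (Fin n))
    {c : T → QVec (Fin n)} (hc : ∀ t, normSq (c t) = 1) : A.hit t U c ≤ 1 := by
  refine (normSq_proj_le _ ?_ _).trans_eq (A.normSq_output U hc)
  rw [normSq_applyU, hc]

theorem Adversary.continuous_hit (A : Adversary n T) (t : T) (c : T → QVec (Fin n)) :
    Continuous fun U => A.hit t U c := by
  refine continuous_normSq (continuous_applyOn _ ?_ ?_)
  · have h := continuous_applyU (c t)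
    exact h.matrix_vecMulVec h.star
  · refine Circuit.continuous_run _ (continuous_pi fun x => Continuous.mul ?_ continuous_const)
    exact (continuous_apply _).comp (OracleCircuit.continuous_run _ continuous_id continuous_const)

theorem tensor_sub {ι κ : Type*} (φ φ' : QVec ι) (χ : QVec κ) :
    tensor φ χ - tensor φ' χ = tensor (φ - φ') χ := by
  funext x; simp [tensor, sub_mul]

/-- Reprogramming the oracle on the challenge state: the response hits a random basis vector only
by chance, and the oracle queries rarely touch the challenge. -/
theorem Adversary.uniformAvg_hit_exchange_le (A : Adversary n T) (t : T) (V Q : QUnitary (Fin n))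
    {c : T → QVec (Fin n)} (hc : ∀ t, normSq (c t) = 1)
    (hQ : applyU Q (zeroState (Fin n)) = c t) :
    uniformAvg (fun j => A.hit t (V * exchange Q j) c) ≤ 2 * (1 / 2) ^ n +
      16 * A.learn.length * ((OracleCircuit.queries V A.learn (zeroState _)).map fun q =>
        normSq (applyOn q.1 (proj (c t)) q.2) + (1 / 2) ^ n).sum := by
  set qs := OracleCircuit.queries V A.learn (zeroState (Fin A.work)) with hqs
  have hcard : ∀ B (e : Fin n ↪ Fin A.work) (ξ : QVec (Fin A.work)), normSq ξ = 1 →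
      uniformAvg (fun j => normSq (applyOn e (proj (applyU B (basisState j))) ξ)) =
        (1 / 2) ^ n := by
    intro B e ξ hξ
    rw [uniformAvg, sum_normSq_proj, hξ]
    simp
  have hcard' : ∀ (B : QUnitary (Fin n)) (e : Fin n ↪ Fin A.work ⊕ (T × Fin n)) ξ, normSq ξ = 1 →
      uniformAvg (fun j => normSq (applyOn e (proj (applyU B (basisState j))) ξ)) =
        (1 / 2) ^ n := by
    intro B e ξ hξ
    rw [uniformAvg, sum_normSq_proj, hξ]
    simp
  have h1 : ∀ j, A.hit t (V * exchange Q j) c ≤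
      2 * normSq (applyOn (respWires A.work n t) (proj (applyU (V * Q) (basisState j)))
        (A.output V c)) +
      2 * (A.learn.length * (qs.map fun q =>
        (8 * normSq (applyOn q.1 (proj (c t)) q.2) +
          8 * normSq (applyOn q.1 (proj (applyU Q (basisState j))) q.2))).sum) := by
    intro j
    set U' := V * exchange Q j with hU'
    -- The correct response is now column `j` of `V * Q`, while the output for the oracle `V` does
    -- not involve `j`.
    have hr : applyU U' (c t) = applyU (V * Q) (basisState j) := by
      rw [hU', applyU_mul, ← hQ, applyU_exchange, ← applyU_mul]
    have hr1 : normSq (applyU (V * Q) (basisState j)) = 1 := by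
      rw [normSq_applyU, normSq_basisState]
    have hsplit : A.output U' c = A.output V c + (A.output U' c - A.output V c) := by abel
    have hdiff : normSq (A.output U' c - A.output V c) ≤ A.learn.length * (qs.map fun q =>
        (8 * normSq (applyOn q.1 (proj (c t)) q.2) +
          8 * normSq (applyOn q.1 (proj (applyU Q (basisState j))) q.2))).sum := by
      -- Only the learning phase uses the oracle, and the response circuit preserves norms; so the
      -- outputs differ as much as the states after learning.
      rw [output, output, ← Circuit.run_sub, Circuit.normSq_run, tensor_sub, normSq_tensor,
        normSq_tensorFamily_of_unit hc, mul_one, ← nrm_sq]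
      have := OracleCircuit.nrm_run_sub_le V (exchange Q j) A.learn (zeroState _) (zeroState _)
      rw [sub_self, nrm_zero, zero_add] at this
      refine (pow_le_pow_left₀ (nrm_nonneg _) this 2).trans ?_
      -- Cauchy–Schwarz over the queries costs one factor of their number.
      refine (List.sq_sum_map_le _ _).trans ?_
      have hle : (qs.map fun q => nrm (applyOn q.1 ((exchange Q j : Matrix _ _ ℂ) - 1) q.2) ^ 2).sum
          ≤ (qs.map fun q => (8 * normSq (applyOn q.1 (proj (c t)) q.2) +
          8 * normSq (applyOn q.1 (proj (applyU Q (basisState j))) q.2))).sum := by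
        refine List.sum_le_sum fun q _ => ?_
        rw [nrm_sq, ← hQ]
        exact normSq_exchange_sub_one_le _ _ _ _
      refine mul_le_mul ?_ hle ?_ (Nat.cast_nonneg _)
      · exact_mod_cast OracleCircuit.length_queries_le _ _ _
      · refine List.sum_nonneg fun a ha => ?_
        obtain ⟨q, _, rfl⟩ := List.mem_map.mp ha
        positivity
    rw [hit, hr, hsplit, applyOn_add]
    refine (normSq_add_le _ _).trans ?_
    gcongr
    exact (normSq_proj_le _ hr1 _).trans hdiff
  refine (uniformAvg_mono h1).trans ?_
  rw [uniformAvg_add, uniformAvg_mul_left, uniformAvg_mul_left, uniformAvg_mul_left,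
    hcard' _ _ _ (A.normSq_output V hc), uniformAvg_list_sum]
  have h2 : (qs.map fun q => uniformAvg fun j =>
      (8 * normSq (applyOn q.1 (proj (c t)) q.2) +
          8 * normSq (applyOn q.1 (proj (applyU Q (basisState j))) q.2))) =
      qs.map fun q => 8 * (normSq (applyOn q.1 (proj (c t)) q.2) + (1 / 2) ^ n) := by
    refine List.map_congr_left fun q hq => ?_
    have hq1 : normSq q.2 = 1 := by
      rw [OracleCircuit.normSq_of_mem_queries _ _ _ q hq, normSq_zeroState]
    rw [uniformAvg_add, uniformAvg_const, uniformAvg_mul_left, hcard _ _ _ hq1]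
    ring
  rw [h2, List.sum_map_mul_left]
  apply le_of_eq
  ring

/-- If the device is Haar random and the challenge is random in an ensemble with small overlaps,
then no adversary returns the correct response. -/
theorem Adversary.uniformAvg_integral_hit_le {K : Type*} [Fintype K] [Nonempty K]
    (A : Adversary n T) (t : T) (c : K → T → QVec (Fin n)) (hc : ∀ k t, normSq (c k t) = 1) :
    uniformAvg (fun k => ∫ V, A.hit t V (c k) ∂(haarUnitary n)) ≤ 2 * (1 / 2) ^ n +
      16 * A.learn.length ^ 2 * (√(meanOverlap fun k => c k t) + (1 / 2) ^ n) := by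
  choose Q hQ using fun k => exists_applyU_zeroState (hc k t)
  have h1 : ∀ k, ∫ V, A.hit t V (c k) ∂(haarUnitary n) =
      ∫ V, uniformAvg (fun j => A.hit t (V * exchange (Q k) j) (c k)) ∂(haarUnitary n) :=
    fun k => integral_eq_integral_uniformAvg_mul (A.continuous_hit t (c k)) _
  have hcont : ∀ k, Continuous fun V => uniformAvg fun j =>
      A.hit t (V * exchange (Q k) j) (c k) := fun k => continuous_uniformAvg fun j =>
        (A.continuous_hit t (c k)).comp (continuous_mul_const _)
  simp only [h1]
  rw [← integral_uniformAvg hcont]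
  set R := 2 * (1 / 2 : ℝ) ^ n +
      16 * A.learn.length ^ 2 * (√(meanOverlap fun k => c k t) + (1 / 2) ^ n) with hR
  -- After averaging over `j` and `k` the bound holds for each fixed `V`; the Haar measure was
  -- needed only for its invariance.
  have h2 : ∀ V, uniformAvg (fun k => uniformAvg fun j =>
      A.hit t (V * exchange (Q k) j) (c k)) ≤ R := by
    intro V
    refine (uniformAvg_mono fun k => A.uniformAvg_hit_exchange_le t V (Q k) (hc k) (hQ k)).trans ?_
    rw [uniformAvg_add, uniformAvg_const, uniformAvg_mul_left, uniformAvg_list_sum, hR]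
    have h3 : ((OracleCircuit.queries V A.learn (zeroState _)).map fun q => uniformAvg fun k =>
        normSq (applyOn q.1 (proj (c k t)) q.2) + (1 / 2 : ℝ) ^ n).sum ≤
        A.learn.length * (√(meanOverlap fun k => c k t) + (1 / 2) ^ n) := by
      -- The query inputs are determined by `V` before any challenge is seen, so they are fixed
      -- states with respect to the random `k`.
      have h4 : ∀ q ∈ OracleCircuit.queries V A.learn (zeroState _), (uniformAvg fun k =>
          normSq (applyOn q.1 (proj (c k t)) q.2) + (1 / 2 : ℝ) ^ n) ≤
          √(meanOverlap fun k => c k t) + (1 / 2) ^ n := by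
        intro q hq
        rw [uniformAvg_add, uniformAvg_const]
        gcongr
        refine uniformAvg_normSq_proj_le (fun k => hc k t) _ ?_
        rw [OracleCircuit.normSq_of_mem_queries _ _ _ q hq, normSq_zeroState]
      refine (List.sum_le_card_nsmul _ (√(meanOverlap fun k => c k t) + (1 / 2) ^ n) ?_).trans ?_
      · intro a ha
        obtain ⟨q, hq, rfl⟩ := List.mem_map.mp ha
        exact h4 q hq
      · rw [nsmul_eq_mul, List.length_map]
        gcongr
        exact OracleCircuit.length_queries_le _ _ _
    have h5 := mul_le_mul_of_nonneg_left h3 (by positivity : (0 : ℝ) ≤ 16 * A.learn.length)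
    linarith
  calc ∫ V, uniformAvg (fun k => uniformAvg fun j =>
        A.hit t (V * exchange (Q k) j) (c k)) ∂(haarUnitary n)
      ≤ ∫ _V, R ∂(haarUnitary n) :=
        integral_mono (integrable_haarUnitary (continuous_uniformAvg hcont))
          (integrable_const R) h2
    _ = R := by simp

end Response

/-! ## Acceptance probability of the verification -/

section Accept

variable {n w M : ℕ} {T : Type} [Fintype T] [DecidableEq T]

/-- Register `q` of the tests. -/
def regWires (w n M : ℕ) {T : Type} (q : T × Fin (M + 1)) :
    Fin n ↪ Fin w ⊕ ((T × Fin (M + 1)) × Fin n) :=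
  ⟨fun i => Sum.inr (q, i), fun i j h => by simpa using h⟩

/-- The qubits of the adversary and of the responses. -/
def advWires (w n M : ℕ) (T : Type) : Fin w ⊕ (T × Fin n) ↪ Fin w ⊕ ((T × Fin (M + 1)) × Fin n) :=
  ⟨Sum.map id fun q => ((q.1, 0), q.2), Function.Injective.sumMap Function.injective_id
    fun p q h => by
      simp only [Prod.mk.injEq] at h
      exact Prod.ext h.1.1 h.2⟩

/-- The qubits of the stored copies. -/
def storedWires (w n M : ℕ) (T : Type) :
    (T × Fin M) × Fin n ↪ Fin w ⊕ ((T × Fin (M + 1)) × Fin n) :=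
  ⟨fun q => Sum.inr ((q.1.1, q.1.2.succ), q.2), fun p q h => by
    simp only [Sum.inr.injEq, Prod.mk.injEq, Fin.succ_inj] at h
    exact Prod.ext (Prod.ext h.1.1 h.1.2) h.2⟩

theorem regWires_apply {T : Type} (q : T × Fin (M + 1)) (i : Fin n) :
    regWires w n M q i = Sum.inr (q, i) := rfl

theorem advWires_inl {T : Type} (i : Fin w) : advWires w n M T (Sum.inl i) = Sum.inl i := rfl

theorem advWires_inr {T : Type} (q : T × Fin n) :
    advWires w n M T (Sum.inr q) = Sum.inr ((q.1, 0), q.2) := rfl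

theorem storedWires_apply {T : Type} (q : (T × Fin M) × Fin n) :
    storedWires w n M T q = Sum.inr ((q.1.1, q.1.2.succ), q.2) := rfl

theorem withStored_eq {T : Type} [Fintype T] (Ψ : QVec (Fin w ⊕ (T × Fin n))) (r : T → QVec (Fin n)) :
    withStored M Ψ r = fun x => Ψ (x ∘ advWires w n M T) *
      ∏ q : T × Fin M, r q.1 (x ∘ regWires w n M (q.1, q.2.succ)) := by
  funext x
  rw [Fintype.prod_prod_type, withStored]
  congr 2
  funext z
  cases z <;> rfl

theorem normSq_withStored (Ψ : QVec (Fin w ⊕ (T × Fin n))) {r : T → QVec (Fin n)}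
    (hr : ∀ t, normSq (r t) = 1) : normSq (withStored M Ψ r) = normSq Ψ := by
  have h := normSq_mul_comp (advWires w n M T) (storedWires w n M T)
    (by rintro (a | a) b <;> simp [advWires_inl, advWires_inr, storedWires_apply, (Fin.succ_ne_zero _).symm])
    (by simp; ring) Ψ (tensorFamily fun q => r q.1)
  rw [normSq_tensorFamily] at h
  simp only [hr, Finset.prod_const_one, mul_one] at h
  rw [← h, withStored_eq]
  rfl

theorem applyOn_regWires_zero {T : Type} [Fintype T] (G : Matrix (Fin n → Bool) (Fin n → Bool) ℂ)
    (t : T)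
    (Ψ : QVec (Fin w ⊕ (T × Fin n))) (r : T → QVec (Fin n)) :
    applyOn (regWires w n M (t, 0)) G (withStored M Ψ r) =
      withStored M (applyOn (respWires w n t) G Ψ) r := by
  have he : regWires w n M (t, 0) = (respWires w n t).trans (advWires w n M T) := rfl
  rw [withStored_eq, withStored_eq, applyOn_mul_of_indep]
  · rw [he, applyOn_comp_trans]
  · intro y x
    refine Finset.prod_congr rfl fun q _ => ?_
    rw [extend_comp_of_disjoint]
    intro i j
    simp [regWires_apply, (Fin.succ_ne_zero _).symm]

theorem applyOn_regWires_succ {r : T → QVec (Fin n)} (hr : ∀ t, normSq (r t) = 1) (t : T)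
    (j : Fin M) (Ψ : QVec (Fin w ⊕ (T × Fin n))) :
    applyOn (regWires w n M (t, j.succ)) (proj (r t)) (withStored M Ψ r) = withStored M Ψ r := by
  have h : withStored M Ψ r = fun x => r t (x ∘ regWires w n M (t, j.succ)) *
      (Ψ (x ∘ advWires w n M T) * ∏ q ∈ Finset.univ.erase (t, j),
        r q.1 (x ∘ regWires w n M (q.1, q.2.succ))) := by
    rw [withStored_eq]
    funext x
    rw [← Finset.mul_prod_erase Finset.univ _ (Finset.mem_univ (t, j))]
    ring
  rw [h, applyOn_proj_of_eq _ (hr t)]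
  intro y x
  simp only
  congr 1
  · rw [extend_comp_of_disjoint]
    rintro i (a | a) <;> simp [regWires_apply, advWires_inl, advWires_inr]
  · refine Finset.prod_congr rfl fun q hq => ?_
    rw [extend_comp_of_disjoint]
    intro i k h
    have h1 := (Finset.mem_erase.mp hq).1
    simp only [regWires_apply, Sum.inr.injEq, Prod.mk.injEq,
      Fin.succ_inj] at h
    exact h1 (Prod.ext h.1.1.symm h.1.2.symm)

/-- The cyclic shifts as permutations of the qubits. -/
def shiftPerm (w n : ℕ) {M : ℕ} {T : Type} (v : T → Fin (M + 1)) :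
    Equiv.Perm (Fin w ⊕ ((T × Fin (M + 1)) × Fin n)) :=
  Equiv.sumCongr (Equiv.refl _) (Equiv.prodCongr
    (Equiv.prodShear (Equiv.refl _) fun t => Equiv.addRight (v t)) (Equiv.refl _))

theorem shiftRegisters_eq {T : Type} (v : T → Fin (M + 1))
    (Ψ : QVec (Fin w ⊕ ((T × Fin (M + 1)) × Fin n))) :
    shiftRegisters v Ψ = fun x => Ψ (x ∘ shiftPerm w n v) := by
  funext x
  rw [shiftRegisters]
  congr 1
  funext z
  cases z <;> rfl

theorem normSq_shiftRegisters (v : T → Fin (M + 1))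
    (Ψ : QVec (Fin w ⊕ ((T × Fin (M + 1)) × Fin n))) :
    normSq (shiftRegisters v Ψ) = normSq Ψ := by
  rw [shiftRegisters_eq]
  exact (Equiv.arrowCongr (shiftPerm w n v).symm (Equiv.refl Bool)).sum_comp fun x => ‖Ψ x‖ ^ 2

/-- The shift moves register `j` of test `t` to position `j + v t`. The response thus ends up at
position `v t`, and all other positions of the test hold stored copies. -/
theorem applyOn_shiftRegisters {T : Type} (G : Matrix (Fin n → Bool) (Fin n → Bool) ℂ)
    (v : T → Fin (M + 1)) (t : T) (j : Fin (M + 1))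
    (Ψ : QVec (Fin w ⊕ ((T × Fin (M + 1)) × Fin n))) :
    applyOn (regWires w n M (t, j + v t)) G (shiftRegisters v Ψ) =
      shiftRegisters v (applyOn (regWires w n M (t, j)) G Ψ) := by
  have he : regWires w n M (t, j + v t) =
    (regWires w n M (t, j)).trans (shiftPerm w n v).toEmbedding := rfl
  rw [shiftRegisters_eq, shiftRegisters_eq, he, applyOn_perm]

/-- Two different shifts overlap only if some response is correct. -/
theorem norm_ip_shiftRegisters_le {r : T → QVec (Fin n)} (hr : ∀ t, normSq (r t) = 1)
    (Ψ : QVec (Fin w ⊕ (T × Fin n))) {v v' : T → Fin (M + 1)} {t : T} (h : v t ≠ v' t) :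
    ‖ip (shiftRegisters v (withStored M Ψ r)) (shiftRegisters v' (withStored M Ψ r))‖ ≤
      normSq (applyOn (respWires w n t) (proj (r t)) Ψ) := by
  set Φ := withStored M Ψ r
  -- After the shift by `v'`, position `v t` holds the register with index `v t - v' t`, a stored
  -- copy because this index is not zero.
  have fix : ∀ v v' : T → Fin (M + 1), v t ≠ v' t →
      applyOn (regWires w n M (t, v t)) (proj (r t)) (shiftRegisters v' Φ) =
        shiftRegisters v' Φ := by
    intro v v' h
    obtain ⟨j, hj⟩ := Fin.exists_succ_eq.mpr (sub_ne_zero.mpr h)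
    have := applyOn_shiftRegisters (proj (r t)) v' t j.succ Φ
    rwa [hj, sub_add_cancel, ← hj, applyOn_regWires_succ hr] at this
  have move : ∀ v : T → Fin (M + 1),
      nrm (applyOn (regWires w n M (t, v t)) (proj (r t)) (shiftRegisters v Φ)) =
        nrm (applyOn (respWires w n t) (proj (r t)) Ψ) := by
    intro v
    have := applyOn_shiftRegisters (proj (r t)) v t 0 Φ
    rw [zero_add] at this
    refine nrm_of_normSq_eq ?_
    rw [this, normSq_shiftRegisters, applyOn_regWires_zero, normSq_withStored _ hr]
  have hdis : ∀ i j, regWires w n M (t, v t) i ≠ regWires w n M (t, v' t) j := by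
    intro i j hij
    simp only [regWires_apply, Sum.inr.injEq, Prod.mk.injEq] at hij
    exact h hij.1.2
  -- Each state is fixed by the projection at the position where the other one has its response.
  -- With both projections inserted, Cauchy–Schwarz gives the probability of a correct response
  -- itself and not only its square root.
  have key : ip (shiftRegisters v Φ) (shiftRegisters v' Φ) =
      ip (applyOn (regWires w n M (t, v t)) (proj (r t)) (shiftRegisters v Φ))
        (applyOn (regWires w n M (t, v' t)) (proj (r t)) (shiftRegisters v' Φ)) := by
    rw [ip_applyOn_proj, applyOn_comm _ _ fun i j => (hdis j i).symm, fix v' v h.symm,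
      ← ip_applyOn_proj, fix v v' h]
  rw [key]
  refine (norm_ip_le _ _).trans_eq ?_
  rw [move, move, ← nrm_sq, sq]

/-- The tests accept with at most the probability of guessing their result, plus what the correct
responses contribute. -/
theorem Adversary.acceptProb_le (A : Adversary n T) (M : ℕ) (U : QUnitary (Fin n))
    {c : T → QVec (Fin n)} (hc : ∀ t, normSq (c t) = 1) :
    A.acceptProb M U c ≤ 1 / ((M : ℝ) + 1) ^ Fintype.card T +
      1 / (((M : ℝ) + 1) ^ Fintype.card T) ^ 2 * ∑ v : T → Fin (M + 1), ∑ v' : T → Fin (M + 1),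
        if h : v = v' then 0 else A.hit (Function.ne_iff.mp h).choose U c := by
  set r := fun t => applyU U (c t) with hr_def
  have hr : ∀ t, normSq (r t) = 1 := fun t => by rw [hr_def, normSq_applyU, hc]
  set Φ := withStored M (A.output U c) r with hΦ
  have hΦ1 : normSq Φ = 1 := by rw [hΦ, normSq_withStored _ hr, A.normSq_output U hc]
  set D : ℝ := ((M : ℝ) + 1) ^ Fintype.card T with hD
  have hD0 : 0 < D := by positivity
  have hcard : (Fintype.card (T → Fin (M + 1)) : ℝ) = D := by simp [hD]
  have h1 : afterTests Φ = ((D⁻¹ : ℝ) : ℂ) • ∑ v : T → Fin (M + 1), shiftRegisters v Φ := by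
    funext x
    simp [afterTests, hD]
  have h2 : normSq (∑ v : T → Fin (M + 1), shiftRegisters v Φ) ≤ D +
      ∑ v : T → Fin (M + 1), ∑ v' : T → Fin (M + 1),
        if h : v = v' then 0 else A.hit (Function.ne_iff.mp h).choose U c := by
    -- The chosen `t` depends on the two shifts but not on the device or the challenges, so averages
    -- over the keys can later be taken term by term.
    have h3 : ∀ v v' : T → Fin (M + 1), (ip (shiftRegisters v Φ) (shiftRegisters v' Φ)).re ≤
        (if v = v' then 1 else 0) +
          if h : v = v' then 0 else A.hit (Function.ne_iff.mp h).choose U c := by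
      intro v v'
      by_cases h : v = v'
      · subst h
        rw [← normSq_eq_re_ip, normSq_shiftRegisters, hΦ1]
        simp
      · rw [if_neg h, dif_neg h, zero_add]
        exact (Complex.re_le_norm _).trans
          (norm_ip_shiftRegisters_le hr _ (Function.ne_iff.mp h).choose_spec)
    rw [normSq_eq_re_ip, ip_sum_left, Complex.re_sum]
    simp only [ip_sum_right, Complex.re_sum]
    refine (Finset.sum_le_sum fun v _ => Finset.sum_le_sum fun v' _ => h3 v v').trans_eq ?_
    simp only [Finset.sum_add_distrib]
    simp [← hcard]
  rw [acceptProb, ← hr_def, ← hΦ, h1, normSq_smul, Complex.norm_real, Real.norm_eq_abs, sq_abs]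
  refine (mul_le_mul_of_nonneg_left h2 (by positivity)).trans_eq ?_
  field_simp

/-- It suffices to bound the average probability that a given response is correct. -/
theorem Adversary.uniformAvg_acceptProb_le {K : Type*} [Fintype K] (A : Adversary n T) (M : ℕ)
    (U : K → QUnitary (Fin n)) {c : K → T → QVec (Fin n)} (hc : ∀ k t, normSq (c k t) = 1) {B : ℝ}
    (hB0 : 0 ≤ B) (hB : ∀ t, uniformAvg (fun k => A.hit t (U k) (c k)) ≤ B) :
    uniformAvg (fun k => A.acceptProb M (U k) (c k)) ≤
      1 / ((M : ℝ) + 1) ^ Fintype.card T + B := by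
  refine (uniformAvg_mono fun k => A.acceptProb_le M (U k) (hc k)).trans ?_
  set D : ℝ := ((M : ℝ) + 1) ^ Fintype.card T with hD
  have hD0 : 0 < D := by positivity
  have hcard : (Fintype.card (T → Fin (M + 1)) : ℝ) = D := by simp [hD]
  rw [uniformAvg_add, uniformAvg_mul_left, uniformAvg_sum]
  simp only [uniformAvg_sum]
  have h1 : ∀ v v' : T → Fin (M + 1), uniformAvg (fun k => if h : v = v' then 0 else
      A.hit (Function.ne_iff.mp h).choose (U k) (c k)) ≤ B := by
    intro v v'
    by_cases h : v = v'
    · simpa [h, uniformAvg] using hB0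
    · simpa [h] using hB _
  -- The number $D^2$ of pairs cancels the prefactor, so the error is `B` regardless of the number
  -- of tests.
  have h2 : ∑ v : T → Fin (M + 1), ∑ v' : T → Fin (M + 1), uniformAvg (fun k =>
      if h : v = v' then 0 else A.hit (Function.ne_iff.mp h).choose (U k) (c k)) ≤ D ^ 2 * B := by
    refine (Finset.sum_le_sum fun v _ => Finset.sum_le_sum fun v' _ => h1 v v').trans_eq ?_
    simp only [Finset.sum_const, Finset.card_univ, nsmul_eq_mul, hcard]
    ring
  refine add_le_add (uniformAvg_const_le (by positivity)) ?_
  refine (mul_le_mul_of_nonneg_left h2 (by positivity)).trans_eq ?_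
  field_simp

end Accept

/-! ## Preparing states -/

section Prepare

variable {ι κ : Type*} [Fintype ι] [DecidableEq ι] [Fintype κ] [DecidableEq κ]

theorem notGate_basisState (a : ι) (b : ι → Bool) :
    (notGate a).apply (basisState b) = basisState (Function.update b a (!b a)) := by
  funext x
  rw [notGate_apply]
  have : Function.update x a (!x a) = b ↔ x = Function.update b a (!b a) := by
    constructor
    · rintro rfl; simp
    · rintro rfl; simp
  simp [basisState, this]

theorem exists_run_eq_basisState (b : ι → Bool) :
    ∃ C : Circuit ι, C.length ≤ Fintype.card ι ∧ C.run (zeroState ι) = basisState b := by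
  have h : ∀ S : Finset ι, ∃ C : Circuit ι, C.length = S.card ∧
      C.run (zeroState ι) = basisState fun i => decide (i ∈ S) := by
    intro S
    induction S using Finset.induction_on with
    | empty => exact ⟨[], rfl, by simp [Circuit.run, zeroState]⟩
    | insert a S ha ih =>
      obtain ⟨C, hl, hC⟩ := ih
      refine ⟨C ++ [notGate a], by simp [hl, ha], ?_⟩
      rw [Circuit.run_append, hC, Circuit.run_cons, Circuit.run_nil, notGate_basisState]
      congr 1
      funext i
      by_cases hi : i = a
      · subst hi; simp [ha]
      · simp [hi]
  obtain ⟨C, hl, hC⟩ := h (Finset.univ.filter fun i => b i = true)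
  refine ⟨C, hl.le.trans (Finset.card_filter_le _ _), ?_⟩
  simpa using hC

theorem tensor_basisState {ι κ : Type*} [Fintype ι] [Fintype κ] (b : ι → Bool) (c : κ → Bool) :
    tensor (basisState b) (basisState c) = basisState (Sum.elim b c) := by
  funext x
  have : x = Sum.elim b c ↔ x ∘ Sum.inl = b ∧ x ∘ Sum.inr = c := by
    constructor
    · rintro rfl; simp
    · rintro ⟨rfl, rfl⟩; simp
  simp only [tensor, basisState, this]
  split_ifs <;> simp_all

/-- Preparing several states on separate registers. -/
theorem exists_run_eq_tensorFamily {O : Type*} [Fintype O] [DecidableEq O] {L : ℕ}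
    {st : O → QVec ι} (h : ∀ o, ∃ C : Circuit ι, C.length ≤ L ∧ C.run (zeroState ι) = st o) :
    ∃ C : Circuit (O × ι), C.length ≤ Fintype.card O * L ∧
      C.run (zeroState (O × ι)) = tensorFamily st := by
  choose P hP hrun using h
  have key : ∀ S : Finset O, ∃ C : Circuit (O × ι), C.length ≤ S.card * L ∧
      C.run (zeroState (O × ι)) = tensorFamily fun o => if o ∈ S then st o else zeroState ι := by
    intro S
    induction S using Finset.induction_on with
    | empty =>
      refine ⟨[], by simp, ?_⟩
      funext x
      simp only [Circuit.run_nil, tensorFamily, zeroState, basisState, Finset.notMem_empty,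
        if_false, Finset.prod_ite_zero, Finset.prod_const_one]
      congr 1
      simp [funext_iff]
    | insert a S ha ih =>
      obtain ⟨C, hl, hC⟩ := ih
      let j : ι ↪ O × ι := ⟨fun i => (a, i), fun _ _ h => (Prod.mk.inj h).2⟩
      refine ⟨C ++ (P a).map j, ?_, ?_⟩
      · rw [List.length_append, Circuit.length_map, Finset.card_insert_of_notMem ha, add_mul,
          one_mul]
        exact add_le_add hl (hP a)
      -- The states of all registers except `a` form a factor that the preparation of `a` leaves
      -- alone.
      · have hind : IndepOf j fun x : O × ι → Bool => ∏ o ∈ Finset.univ.erase a,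
            (if o ∈ S then st o else zeroState ι) fun i => x (o, i) := by
          intro y x
          refine Finset.prod_congr rfl fun o ho => ?_
          refine congrArg _ (funext fun i => Function.extend_apply' _ _ _ ?_)
          rintro ⟨k, hk⟩
          exact (Finset.mem_erase.mp ho).1 (congrArg Prod.fst hk).symm
        have h1 : (tensorFamily fun o => if o ∈ S then st o else zeroState ι) =
            fun x => zeroState ι (x ∘ j) * ∏ o ∈ Finset.univ.erase a,
              (if o ∈ S then st o else zeroState ι) fun i => x (o, i) := by
          funext x
          rw [tensorFamily, ← Finset.mul_prod_erase Finset.univ _ (Finset.mem_univ a), if_neg ha]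
          rfl
        rw [Circuit.run_append, hC, h1, Circuit.run_map_mul j _ _ hind, hrun]
        funext x
        rw [tensorFamily, ← Finset.mul_prod_erase Finset.univ _ (Finset.mem_univ a),
          if_pos (Finset.mem_insert_self a S)]
        congr 1
        refine Finset.prod_congr rfl fun o ho => ?_
        simp [Finset.mem_insert, (Finset.mem_erase.mp ho).1]
  obtain ⟨C, hl, hC⟩ := key Finset.univ
  exact ⟨C, hl, by simpa using hC⟩

end Prepare

/-! ## Distinguishers -/

section Transport

variable {ι ι' : Type*} [Fintype ι] [DecidableEq ι] [Fintype ι'] [DecidableEq ι']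

theorem prOne_comp_equiv (σ : ι ≃ ι') (a : ι) (ψ : QVec ι) :
    prOne (σ a) (fun x => ψ (x ∘ σ)) = prOne a ψ := by
  refine Fintype.sum_equiv (Equiv.arrowCongr σ.symm (Equiv.refl Bool)) _ _ fun x => ?_
  rfl

/-- Relabelling of qubits: distinguishers are built on sums of named registers but defined on
numbered qubits. -/
theorem prOne_run_map_equiv {n : ℕ} (σ : ι ≃ ι') (a : ι) (C : OracleCircuit n ι)
    (U : QUnitary (Fin n)) (ψ : QVec ι) :
    prOne (σ a) ((C.map σ.toEmbedding).run U fun x => ψ (x ∘ σ)) = prOne a (C.run U ψ) := by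
  have := OracleCircuit.run_map_mul σ.toEmbedding C U ψ (h := fun _ => 1) fun _ _ => rfl
  simp only [mul_one] at this
  rw [← prOne_comp_equiv σ a]
  exact congrArg (prOne (σ a)) this

theorem zeroState_comp_equiv (σ : ι ≃ ι') :
    (fun x : ι' → Bool => zeroState ι (x ∘ σ)) = zeroState ι' := by
  funext x
  have : x ∘ σ = (fun _ => false) ↔ x = fun _ => false := by
    constructor
    · intro h
      funext i
      simpa using congrFun h (σ.symm i)
    · rintro rfl; rfl
  simp [zeroState, basisState, this]

/-- A distinguisher on an arbitrary set of qubits. -/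
theorem exists_unitaryDistinguisher {n : ℕ} (C : OracleCircuit n ι) (a : ι) :
    ∃ D : UnitaryDistinguisher n, D.size = Fintype.card ι + C.length ∧
      ∀ U, D.prob U = prOne a (C.run U (zeroState ι)) := by
  let σ := Fintype.equivFin ι
  refine ⟨⟨Fintype.card ι, C.map σ.toEmbedding, σ a⟩, ?_, fun U => ?_⟩
  · simp [UnitaryDistinguisher.size, OracleCircuit.length_map]
  · rw [← prOne_run_map_equiv σ, zeroState_comp_equiv]
    rfl

/-- A distinguisher with an arbitrary set of work qubits. -/
theorem exists_stateDistinguisher {n m : ℕ} (C : Circuit (ι ⊕ (Fin m × Fin n)))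
    (a : ι ⊕ (Fin m × Fin n)) :
    ∃ D : StateDistinguisher n m, D.size = Fintype.card ι + C.length ∧
      ∀ φ, D.prob φ = prOne a (C.run (tensor (zeroState ι) (tensorFamily fun _ => φ))) := by
  let σ : ι ⊕ (Fin m × Fin n) ≃ Fin (Fintype.card ι) ⊕ (Fin m × Fin n) :=
    Equiv.sumCongr (Fintype.equivFin ι) (Equiv.refl _)
  refine ⟨⟨Fintype.card ι, C.map σ.toEmbedding, σ a⟩, ?_, fun φ => ?_⟩
  · simp [StateDistinguisher.size, Circuit.length_map]
  · have h1 : tensor (zeroState (Fin (Fintype.card ι))) (tensorFamily fun _ : Fin m => φ) =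
        fun x => tensor (zeroState ι) (tensorFamily fun _ : Fin m => φ) (x ∘ σ) := by
      rw [← zeroState_comp_equiv (Fintype.equivFin ι)]
      rfl
    have h2 := Circuit.run_map_mul σ.toEmbedding C
      (tensor (zeroState ι) (tensorFamily fun _ : Fin m => φ)) (h := fun _ => 1) fun _ _ => rfl
    simp only [mul_one] at h2
    rw [StateDistinguisher.prob, h1, ← prOne_comp_equiv σ a]
    exact congrArg (prOne (σ a)) h2

end Transport

section Distinguishers

variable {γ : Type} [Fintype γ] [DecidableEq γ] {n : ℕ}

/-- The circuit `P` prepares `r`, next to some state of the qubits `γ`. -/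
def Prepares (P : Circuit (γ ⊕ Fin n)) (r : QVec (Fin n)) : Prop :=
  ∃ g : QVec γ, P.run (zeroState _) = tensor g r

theorem extend_apply_of_ne {ι κ : Type*} (e : κ ↪ ι) {a : ι} (h : ∀ i, e i ≠ a)
    (y : κ → Bool) (x : ι → Bool) : Function.extend e y x a = x a :=
  Function.extend_apply' _ _ _ fun ⟨i, hi⟩ => h i hi

/-- The wires for comparing an unknown state with a state that can be prepared. -/
abbrev OverlapWires (γ : Type) (n : ℕ) := (Unit ⊕ (γ ⊕ Fin n)) ⊕ (Fin 1 × Fin n)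

/-- The wires of the preparation. -/
def overlapPrep (γ : Type) (n : ℕ) : γ ⊕ Fin n ↪ OverlapWires γ n :=
  ⟨fun i => Sum.inl (Sum.inr i), fun _ _ h => by simpa using h⟩

/-- The wires of the comparison. -/
def overlapSwap (γ : Type) (n : ℕ) : SwapWires n (OverlapWires γ n) where
  ctl := Sum.inl (Sum.inl ())
  fst := ⟨fun i => Sum.inr (0, i), fun _ _ h => by simpa using h⟩
  snd := ⟨fun i => Sum.inl (Sum.inr (Sum.inr i)), fun _ _ h => by simpa using h⟩
  ctl_ne_fst := fun _ => Sum.inl_ne_inr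
  ctl_ne_snd := fun _ h => by simpa using Sum.inl_injective h
  fst_ne_snd := fun _ _ => Sum.inr_ne_inl

/-- Comparing an unknown state with a state that can be prepared. -/
theorem exists_overlap_distinguisher {P : Circuit (γ ⊕ Fin n)} {r : QVec (Fin n)}
    (hP : Prepares P r) (hr : normSq r = 1) :
    ∃ D : StateDistinguisher n 1, D.size = Fintype.card γ + 2 * n + P.length + 3 ∧
      ∀ ψ, normSq ψ = 1 → D.prob ψ = (1 - ‖ip r ψ‖ ^ 2) / 2 := by
  obtain ⟨g, hg⟩ := hP
  set jP := overlapPrep γ n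
  have jP_apply : ∀ i, jP i = Sum.inl (Sum.inr i) := fun _ => rfl
  set w := overlapSwap γ n
  have ctl_eq : w.ctl = Sum.inl (Sum.inl ()) := rfl
  have fst_apply : ∀ i, w.fst i = Sum.inr (0, i) := fun _ => rfl
  have snd_apply : ∀ i, w.snd i = Sum.inl (Sum.inr (Sum.inr i)) := fun _ => rfl
  obtain ⟨D, hD, hprob⟩ := exists_stateDistinguisher (P.map jP ++ w.test) w.ctl
  refine ⟨D, ?_, fun ψ hψ => ?_⟩
  · rw [hD, List.length_append, Circuit.length_map, w.length_test]
    simp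
    ring
  -- The factor `z` is the control qubit in the state 0.
  · set z : QVec (OverlapWires γ n) := fun x => if x w.ctl = false then 1 else 0 with hz
    set Ψ0 : QVec (OverlapWires γ n) := tensor (zeroState _) (tensorFamily fun _ : Fin 1 => ψ) with hΨ0
    have h0 : Ψ0 = fun x => zeroState (γ ⊕ Fin n) (x ∘ jP) * (z x * ψ (x ∘ w.fst)) := by
      funext x
      have hx : x ∘ Sum.inl = (fun _ => false) ↔
          x ∘ jP = (fun _ => false) ∧ x w.ctl = false := by
        constructor
        · intro h
          exact ⟨funext fun i => congrFun h (Sum.inr i), congrFun h (Sum.inl ())⟩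
        · rintro ⟨h1, h2⟩
          funext i
          rcases i with i | i
          · exact h2
          · exact congrFun h1 i
      have h3 : tensorFamily (fun _ : Fin 1 => ψ) (x ∘ Sum.inr) = ψ (x ∘ w.fst) := by
        simp only [tensorFamily, Finset.univ_unique, Finset.prod_singleton]
        rfl
      rw [hΨ0, tensor, h3, zeroState, zeroState, basisState, basisState, hz]
      simp only [hx]
      by_cases h1 : x ∘ jP = fun _ => false <;> by_cases h2 : x w.ctl = false <;> simp [h1, h2]
    have hind0 : IndepOf jP fun x => z x * ψ (x ∘ w.fst) := by
      intro y x
      have h1 : Function.extend jP y x w.ctl = x w.ctl :=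
        extend_apply_of_ne _ (fun i => by simp [jP_apply, ctl_eq]) _ _
      simp only [hz, h1, extend_comp_of_disjoint jP w.fst fun i j => by
        simp [jP_apply, fst_apply]]
    set Ψ := (P.map jP).run Ψ0 with hΨ
    have h1 : Ψ = fun x => tensor g r (x ∘ jP) * (z x * ψ (x ∘ w.fst)) := by
      rw [hΨ, h0, Circuit.run_map_mul jP _ _ hind0, hg]
    have hnorm : normSq Ψ = 1 := by
      rw [hΨ, Circuit.normSq_run, hΨ0, normSq_tensor, normSq_zeroState, one_mul,
        normSq_tensorFamily]
      simp [hψ]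
    -- The same product state is regrouped, here with the prepared state split off and in `h3` with
    -- the unknown one, so that each operator meets a single factor.
    have h2 : Ψ = fun x => r (x ∘ w.snd) *
        (g (fun i => x (Sum.inl (Sum.inr (Sum.inl i)))) * z x * ψ (x ∘ w.fst)) := by
      rw [h1]
      funext x
      have : tensor g r (x ∘ jP) =
        g (fun i => x (Sum.inl (Sum.inr (Sum.inl i)))) * r (x ∘ w.snd) := rfl
      rw [this]
      ring
    have hind2 : IndepOf w.snd fun x =>
        (g (fun i => x (Sum.inl (Sum.inr (Sum.inl i)))) * z x * ψ (x ∘ w.fst)) := by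
      intro y x
      have e1 : Function.extend w.snd y x w.ctl = x w.ctl :=
        extend_apply_of_ne _ (fun i => (w.ctl_ne_snd i).symm) _ _
      have e2 : ∀ i, Function.extend w.snd y x (Sum.inl (Sum.inr (Sum.inl i))) =
          x (Sum.inl (Sum.inr (Sum.inl i))) := fun i =>
        extend_apply_of_ne _ (fun i => by simp [snd_apply]) _ _
      simp only [hz, e1, e2, extend_comp_of_disjoint w.snd w.fst fun i j => (w.fst_ne_snd j i).symm]
    have h3 : Ψ = fun x => ψ (x ∘ w.fst) *
        (g (fun i => x (Sum.inl (Sum.inr (Sum.inl i)))) * z x * r (x ∘ w.snd)) := by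
      rw [h2]; funext x; ring
    have hind3 : IndepOf w.fst fun x =>
        (g (fun i => x (Sum.inl (Sum.inr (Sum.inl i)))) * z x * r (x ∘ w.snd)) := by
      intro y x
      have e1 : Function.extend w.fst y x w.ctl = x w.ctl :=
        extend_apply_of_ne _ (fun i => (w.ctl_ne_fst i).symm) _ _
      have e2 : ∀ i, Function.extend w.fst y x (Sum.inl (Sum.inr (Sum.inl i))) =
          x (Sum.inl (Sum.inr (Sum.inl i))) := fun i =>
        extend_apply_of_ne _ (fun i => by simp [fst_apply]) _ _
      simp only [hz, e1, e2, extend_comp_of_disjoint w.fst w.snd w.fst_ne_snd]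
    have h4 : normSq (applyOn w.fst (proj r) Ψ) = ‖ip r ψ‖ ^ 2 := by
      have e1 : applyOn w.fst (proj r) (fun x => ψ (x ∘ w.fst)) = fun x =>
          applyOn (Function.Embedding.refl _) (proj r) ψ (x ∘ w.fst) :=
        applyOn_comp_trans (Function.Embedding.refl _) w.fst (proj r) ψ
      rw [h3, applyOn_mul_of_indep _ _ hind3, e1, normSq_mul_of_indep_congr w.fst hψ hind3,
        normSq_proj_refl hr]
      rw [← h3, hnorm]
    have h5 : ∀ x, x w.ctl = true → Ψ x = 0 := by
      intro x hx
      rw [h1]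
      simp [hz, hx]
    rw [hprob, Circuit.run_append, w.prOne_test_eq hr hind2 h2 h5 hnorm, h4]

end Distinguishers

/-! ### Simulating the adversary and testing one of its responses. -/

section HitDistinguisher

variable {γ T : Type} [Fintype γ] [DecidableEq γ] [Fintype T] [DecidableEq T] {n : ℕ}

/-- The wires for simulating the adversary and checking one response: a control qubit, the work
qubits, and the preparations of the challenges and of one further state. -/
abbrev HitWires (γ T : Type) (w n : ℕ) := Unit ⊕ (Fin w ⊕ (Option T × (γ ⊕ Fin n)))

/-- The wires of the preparations. -/
def hitPrep (γ T : Type) (w n : ℕ) : Option T × (γ ⊕ Fin n) ↪ HitWires γ T w n :=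
  ⟨fun i => Sum.inr (Sum.inr i), fun _ _ h => by simpa using h⟩

/-- The work qubits of the adversary. -/
def hitWork (γ T : Type) (w n : ℕ) : Fin w ↪ HitWires γ T w n :=
  ⟨fun i => Sum.inr (Sum.inl i), fun _ _ h => by simpa using h⟩

/-- The qubits of the adversary and the challenges. -/
def hitAdv (γ T : Type) (w n : ℕ) : Fin w ⊕ (T × Fin n) ↪ HitWires γ T w n :=
  ⟨fun i => Sum.inr (Sum.map id (fun q => (some q.1, Sum.inr q.2)) i), fun i j h => by
    refine Sum.map_injective.mpr ⟨Function.injective_id, ?_⟩ (Sum.inr_injective h)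
    intro p q h
    simp only [Prod.mk.injEq, Option.some.injEq, Sum.inr.injEq] at h
    exact Prod.ext h.1 h.2⟩

/-- The wires of the comparison. -/
def hitSwap (γ : Type) {T : Type} (w n : ℕ) (t : T) : SwapWires n (HitWires γ T w n) where
  ctl := Sum.inl ()
  fst := ⟨fun i => Sum.inr (Sum.inr (some t, Sum.inr i)), fun _ _ h => by simpa using h⟩
  snd := ⟨fun i => Sum.inr (Sum.inr (none, Sum.inr i)), fun _ _ h => by simpa using h⟩
  ctl_ne_fst := fun _ => Sum.inl_ne_inr
  ctl_ne_snd := fun _ => Sum.inl_ne_inr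
  fst_ne_snd := fun i j h => by simpa using congrArg Prod.fst (Sum.inr_injective (Sum.inr_injective h))

/-- Simulating the adversary and comparing one response with the correct one. -/
theorem exists_hit_distinguisher (A : Adversary n T) (t : T) {c : T → QVec (Fin n)}
    (hc : ∀ t, normSq (c t) = 1) {L : ℕ}
    (hP : ∀ t, ∃ P : Circuit (γ ⊕ Fin n), P.length ≤ L ∧ Prepares P (c t)) :
    ∃ D : UnitaryDistinguisher n,
      D.size ≤ A.size + (Fintype.card T + 1) * (Fintype.card γ + n + L) + n + 4 ∧
      ∀ U, D.prob U = (1 - A.hit t U c) / 2 := by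
  choose P hPl g hg using hP
  -- The index `none` holds a further copy of challenge `t`, which one query turns into the correct
  -- response for the swap test.
  set st : Option T → QVec (γ ⊕ Fin n) :=
    fun o => tensor (g (o.getD t)) (c (o.getD t)) with hst
  obtain ⟨C, hCl, hC⟩ := exists_run_eq_tensorFamily (st := st) (L := L) fun o =>
    ⟨P (o.getD t), hPl _, hg _⟩
  set jO := hitPrep γ T A.work n
  set jw := hitWork γ T A.work n
  set jA := hitAdv γ T A.work n
  set w := hitSwap γ A.work n t
  have jO_apply : ∀ i, jO i = Sum.inr (Sum.inr i) := fun _ => rfl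
  have jw_apply : ∀ i, jw i = Sum.inr (Sum.inl i) := fun _ => rfl
  have jA_inl : ∀ i, jA (Sum.inl i) = Sum.inr (Sum.inl i) := fun _ => rfl
  have jA_inr : ∀ q, jA (Sum.inr q) = Sum.inr (Sum.inr (some q.1, Sum.inr q.2)) := fun _ => rfl
  have ctl_eq : w.ctl = Sum.inl () := rfl
  have fst_apply : ∀ i, w.fst i = Sum.inr (Sum.inr (some t, Sum.inr i)) := fun _ => rfl
  have snd_apply : ∀ i, w.snd i = Sum.inr (Sum.inr (none, Sum.inr i)) := fun _ => rfl
  obtain ⟨D, hD, hprob⟩ := exists_unitaryDistinguisher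
    ((C.map jO).toOracle n ++ (A.learn.map jw ++ (OracleStep.query w.snd ::
      (A.respond.map jA ++ w.test).toOracle n))) w.ctl
  refine ⟨D, ?_, fun U => ?_⟩
  · have h1 : D.size = 1 + (A.work + (Fintype.card T + 1) * (Fintype.card γ + n)) +
        (C.length + (A.learn.length + (A.respond.length + (n + 2) + 1))) := by
      rw [hD]
      simp [Circuit.length_toOracle, OracleCircuit.length_map, Circuit.length_map, w.length_test]
    rw [Fintype.card_option] at hCl
    rw [h1, Adversary.size]
    nlinarith
  set z : QVec (HitWires γ T A.work n) := fun x => if x w.ctl = false then 1 else 0 with hz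
  -- The factors `G` are the qubits left over by the preparations. For fixed keys they are in a
  -- product with everything else, so they do not disturb the test.
  set G : Option T → QVec (HitWires γ T A.work n) := fun o x =>
    g (o.getD t) fun i => x (Sum.inr (Sum.inr (o, Sum.inl i))) with hG
  set F : T → QVec (HitWires γ T A.work n) := fun s x =>
    c s fun i => x (Sum.inr (Sum.inr (some s, Sum.inr i))) with hF
  have z_indep : ∀ {κ : Type} (e : κ ↪ HitWires γ T A.work n), (∀ i, e i ≠ w.ctl) → IndepOf e z :=
    fun e h y x => by simp only [hz, extend_apply_of_ne e h]
  have G_indep : ∀ {κ : Type} (e : κ ↪ HitWires γ T A.work n),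
      (∀ i o k, e i ≠ Sum.inr (Sum.inr (o, Sum.inl k))) → ∀ o, IndepOf e (G o) :=
    fun e h o y x => congrArg (g _) (funext fun k => extend_apply_of_ne e (fun i => h i o k) y x)
  have h0 : zeroState (HitWires γ T A.work n) = fun x =>
      zeroState (Option T × (γ ⊕ Fin n)) (x ∘ jO) * (z x * zeroState (Fin A.work) (x ∘ jw)) := by
    funext x
    have hx : x = (fun _ => false) ↔
        x ∘ jO = (fun _ => false) ∧ x w.ctl = false ∧ x ∘ jw = fun _ => false := by
      constructor
      · rintro rfl; exact ⟨rfl, rfl, rfl⟩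
      · rintro ⟨h1, h2, h3⟩
        funext i
        rcases i with i | i | i
        · exact h2
        · exact congrFun h3 i
        · exact congrFun h1 i
    simp only [zeroState, basisState, hz, hx]
    by_cases h1 : x ∘ jO = fun _ => false <;> by_cases h2 : x w.ctl = false <;> simp [h1, h2]
  have hind0 : IndepOf jO fun x => z x * zeroState (Fin A.work) (x ∘ jw) := by
    intro y x
    simp only [z_indep jO (fun i => by simp [jO_apply, ctl_eq]) y x,
      extend_comp_of_disjoint jO jw fun i j => by simp [jO_apply, jw_apply]]
  set a := A.learn.run U (zeroState (Fin A.work)) with ha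
  have h1 : (C.map jO).run (zeroState _) = fun x =>
      zeroState (Fin A.work) (x ∘ jw) * (z x * tensorFamily st (x ∘ jO)) := by
    rw [h0, Circuit.run_map_mul jO _ _ hind0, hC]
    funext x; ring
  have hind1 : IndepOf jw fun x => z x * tensorFamily st (x ∘ jO) := by
    intro y x
    simp only [z_indep jw (fun i => by simp [jw_apply, ctl_eq]) y x,
      extend_comp_of_disjoint jw jO fun i j => by simp [jO_apply, jw_apply]]
  have hprod : ∀ x, tensorFamily st (x ∘ jO) =
      c t (x ∘ w.snd) * (G none x * ((∏ s, G (some s) x) * ∏ s, F s x)) := by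
    intro x
    rw [tensorFamily, Fintype.prod_option]
    have e1 : st none (fun i => (x ∘ jO) (none, i)) = G none x * c t (x ∘ w.snd) := rfl
    have e2 : ∀ s, st (some s) (fun i => (x ∘ jO) (some s, i)) = G (some s) x * F s x :=
      fun s => rfl
    simp only [e1, e2, Finset.prod_mul_distrib]
    ring
  have h2 : (A.learn.map jw).run U ((C.map jO).run (zeroState _)) = fun x =>
      c t (x ∘ w.snd) *
        (a (x ∘ jw) * z x * (G none x * ((∏ s, G (some s) x) * ∏ s, F s x))) := by
    rw [h1, OracleCircuit.run_map_mul jw _ U _ hind1]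
    funext x
    rw [hprod]
    ring
  have hsG : ∀ i o k, w.snd i ≠ Sum.inr (Sum.inr (o, Sum.inl k)) := fun i o k => by
    simp [snd_apply]
  have hsz : ∀ i, w.snd i ≠ w.ctl := fun i => (w.ctl_ne_snd i).symm
  have hind2 : IndepOf w.snd fun x =>
      a (x ∘ jw) * z x * (G none x * ((∏ s, G (some s) x) * ∏ s, F s x)) := by
    intro y x
    have e1 : ∀ s, F s (Function.extend w.snd y x) = F s x := fun s =>
      congrArg (c s) (funext fun k => extend_apply_of_ne _ (fun i => by simp [snd_apply]) _ _)
    simp only [z_indep w.snd hsz y x, G_indep w.snd hsG _ y x, e1,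
      extend_comp_of_disjoint w.snd jw fun i j => by simp [snd_apply, jw_apply]]
  set r := applyU U (c t) with hr
  have hr1 : normSq r = 1 := by rw [hr, normSq_applyU, hc]
  have hquery : applyOn w.snd (U : Matrix _ _ ℂ) (fun x => c t (x ∘ w.snd)) =
      fun x => r (x ∘ w.snd) := by
    funext x
    simp only [applyOn, extend_comp_self]
    rfl
  have h3 : applyOn w.snd (U : Matrix _ _ ℂ)
      ((A.learn.map jw).run U ((C.map jO).run (zeroState _))) = fun x =>
      tensor a (tensorFamily c) (x ∘ jA) *
        (z x * (G none x * ∏ s, G (some s) x) * r (x ∘ w.snd)) := by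
    rw [h2, applyOn_mul_of_indep _ _ hind2, hquery]
    funext x
    have e1 : tensor a (tensorFamily c) (x ∘ jA) = a (x ∘ jw) * ∏ s, F s x := rfl
    rw [e1]
    ring
  have hind3 : IndepOf jA fun x => z x * (G none x * ∏ s, G (some s) x) * r (x ∘ w.snd) := by
    intro y x
    have e1 : ∀ i, jA i ≠ w.ctl := by rintro (i | i) <;> simp [jA_inl, jA_inr, ctl_eq]
    have e2 : ∀ i o k, jA i ≠ Sum.inr (Sum.inr (o, Sum.inl k)) := by
      rintro (i | i) o k <;> simp [jA_inl, jA_inr]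
    have e3 : ∀ i j, jA i ≠ w.snd j := by
      rintro (i | i) j <;> simp [jA_inl, jA_inr, snd_apply]
    simp only [z_indep jA e1 y x, G_indep jA e2 _ y x, extend_comp_of_disjoint jA w.snd e3]
  set Ψ := (A.respond.map jA).run (applyOn w.snd (U : Matrix _ _ ℂ)
    ((A.learn.map jw).run U ((C.map jO).run (zeroState _)))) with hΨ
  have h4 : Ψ = fun x => A.output U c (x ∘ jA) *
      (z x * (G none x * ∏ s, G (some s) x) * r (x ∘ w.snd)) := by
    rw [hΨ, h3, Circuit.run_map_mul jA _ _ hind3]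
    rfl
  have hnorm : normSq Ψ = 1 := by
    rw [hΨ, Circuit.normSq_run, normSq_applyOn_unitary, OracleCircuit.normSq_run,
      Circuit.normSq_run, normSq_zeroState]
  have h5 : Ψ = fun x => r (x ∘ w.snd) *
      (A.output U c (x ∘ jA) * z x * (G none x * ∏ s, G (some s) x)) := by
    rw [h4]; funext x; ring
  have hind5 : IndepOf w.snd fun x =>
      A.output U c (x ∘ jA) * z x * (G none x * ∏ s, G (some s) x) := by
    intro y x
    have e3 : ∀ j i, w.snd j ≠ jA i := by
      rintro j (i | i) <;> simp [jA_inl, jA_inr, snd_apply]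
    simp only [z_indep w.snd hsz y x, G_indep w.snd hsG _ y x, extend_comp_of_disjoint w.snd jA e3]
  have h6 : ∀ x, x w.ctl = true → Ψ x = 0 := by
    intro x hx
    rw [h4]
    simp [hz, hx]
  have h7 : normSq (applyOn w.fst (proj r) Ψ) = A.hit t U c := by
    have e1 : w.fst = (respWires A.work n t).trans jA := rfl
    have e2 : IndepOf w.fst fun x =>
        z x * (G none x * ∏ s, G (some s) x) * r (x ∘ w.snd) := by
      intro y x
      have f1 : ∀ i, w.fst i ≠ w.ctl := fun i => (w.ctl_ne_fst i).symm
      have f2 : ∀ i o k, w.fst i ≠ Sum.inr (Sum.inr (o, Sum.inl k)) := fun i o k => by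
        simp [fst_apply]
      simp only [z_indep w.fst f1 y x, G_indep w.fst f2 _ y x,
        extend_comp_of_disjoint w.fst w.snd w.fst_ne_snd]
    rw [h4, applyOn_mul_of_indep _ _ e2, e1, applyOn_comp_trans,
      normSq_mul_of_indep_congr jA (A.normSq_output U hc) hind3]
    · rfl
    · rw [← h4, hnorm]
  rw [hprob, OracleCircuit.run_append, Circuit.run_toOracle, OracleCircuit.run_append,
    OracleCircuit.run_cons, Circuit.run_toOracle, Circuit.run_append, ← h7]
  exact w.prOne_test_eq hr1 hind5 h5 h6 hnorm

end HitDistinguisher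

/-! ## Negligible functions -/

section Negligible

theorem PolyBounded.mono {f g : ℕ → ℕ} (hg : PolyBounded g) (h : ∀ s, f s ≤ g s) :
    PolyBounded f := hg.imp fun _ hp s => (h s).trans (hp s)

theorem PolyBounded.add {f g : ℕ → ℕ} (hf : PolyBounded f) (hg : PolyBounded g) :
    PolyBounded fun s => f s + g s := by
  obtain ⟨p, hp⟩ := hf
  obtain ⟨q, hq⟩ := hg
  exact ⟨p + q, fun s => by simpa using add_le_add (hp s) (hq s)⟩

theorem PolyBounded.mul {f g : ℕ → ℕ} (hf : PolyBounded f) (hg : PolyBounded g) :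
    PolyBounded fun s => f s * g s := by
  obtain ⟨p, hp⟩ := hf
  obtain ⟨q, hq⟩ := hg
  exact ⟨p * q, fun s => by simpa using Nat.mul_le_mul (hp s) (hq s)⟩

theorem PolyBounded.const (a : ℕ) : PolyBounded fun _ => a :=
  ⟨Polynomial.C a, fun s => by simp⟩

theorem Negligible.mono {f g : ℕ → ℝ} (hg : Negligible g) (h : ∀ s, |f s| ≤ |g s|) :
    Negligible f := Asymptotics.SuperpolynomialDecay.trans_abs_le hg h

theorem Negligible.add {f g : ℕ → ℝ} (hf : Negligible f) (hg : Negligible g) :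
    Negligible fun s => f s + g s := Asymptotics.SuperpolynomialDecay.add hf hg

theorem Negligible.const_mul {f : ℕ → ℝ} (hf : Negligible f) (a : ℝ) :
    Negligible fun s => a * f s := Asymptotics.SuperpolynomialDecay.const_mul hf a

theorem Negligible.poly_mul {f : ℕ → ℝ} (hf : Negligible f) {p : ℕ → ℕ} (hp : PolyBounded p) :
    Negligible fun s => (p s : ℝ) * f s := by
  obtain ⟨q, hq⟩ := hp
  have h := Asymptotics.SuperpolynomialDecay.polynomial_mul hf (q.map (Nat.castRingHom ℝ))
  refine Negligible.mono h fun s => ?_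
  have : Polynomial.eval (s : ℝ) (q.map (Nat.castRingHom ℝ)) = ((q.eval s : ℕ) : ℝ) := by
    simp
  rw [this, abs_mul, abs_mul, Nat.abs_cast, Nat.abs_cast]
  gcongr
  exact hq s

/-- Decay of $f$ against $s^{2c}$ gives decay of its root against $s^c$. -/
theorem Negligible.sqrt {f : ℕ → ℝ} (hf : Negligible f) : Negligible fun s => √(f s) := by
  intro c
  have h := (Real.continuous_sqrt.tendsto 0).comp (hf (2 * c))
  rw [Real.sqrt_zero] at h
  refine h.congr fun s => ?_
  simp only [Function.comp_apply]
  rw [Real.sqrt_mul (by positivity), mul_comm 2 c, pow_mul, Real.sqrt_sq (by positivity)]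

theorem Negligible.eventually_le_one_div {ε : ℕ → ℝ} (hε : Negligible ε) {f : ℕ → ℕ}
    (hf : PolyBounded f) (hpos : ∀ s, 0 < f s) : ∀ᶠ s in atTop, ε s ≤ 1 / (f s : ℝ) := by
  have h := hε.poly_mul hf 0
  simp only [pow_zero, one_mul] at h
  filter_upwards [h.eventually_lt_const one_pos] with s hs
  have := hpos s
  rw [le_div_iff₀ (by exact_mod_cast this), mul_comm]
  exact hs.le

/-- Security against every choice of polynomial-size distinguishers bounds the advantages of
finitely many distinguishers simultaneously. -/
theorem exists_negligible_bound {X : ℕ → Type*} {size : ∀ s, X s → ℕ} {adv : ∀ s, X s → ℝ}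
    (h : ∀ D : ∀ s, X s, PolyBounded (fun s => size s (D s)) → Negligible fun s => |adv s (D s)|)
    {I : ℕ → Type*} [∀ s, Finite (I s)] [∀ s, Nonempty (I s)] (D : ∀ s, I s → X s) {L : ℕ → ℕ}
    (hL : PolyBounded L) (hD : ∀ s i, size s (D s i) ≤ L s) :
    ∃ ε : ℕ → ℝ, Negligible ε ∧ ∀ s i, |adv s (D s i)| ≤ ε s := by
  -- The worst distinguisher is taken for each `s`. Families need not be uniform, so these form an
  -- admissible family again.
  choose i hi using fun s => Finite.exists_max fun i => |adv s (D s i)|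
  exact ⟨_, h (fun s => D s (i s)) (hL.mono fun s => hD s _), hi⟩

end Negligible

/-! ## Choosing different keys -/

section Keys

variable {ι K L : Type*} [Fintype ι] [DecidableEq ι] [Fintype K] [Fintype L]

theorem uniformAvg_prod (f : K → L → ℝ) :
    uniformAvg (fun p : K × L => f p.1 p.2) = uniformAvg fun k => uniformAvg fun l => f k l := by
  simp only [uniformAvg, Fintype.sum_prod_type, Fintype.card_prod, ← Finset.sum_div, div_div,
    Nat.cast_mul]
  rw [mul_comm]

/-- If `f` is small on average over the key `i` for all values of the other keys, then it is small
on average over different keys. -/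
theorem uniformAvg_embedding_le [Nonempty K] [Fintype (ι ↪ K)] {f : (ι → K) → ℝ}
    (hf0 : ∀ κ, 0 ≤ f κ) (hf1 : ∀ κ, f κ ≤ 1) (i : ι) {G : ℝ}
    (hG : ∀ κ, uniformAvg (fun k => f (Function.update κ i k)) ≤ G) :
    uniformAvg (fun κ : ι ↪ K => f κ) ≤ 2 * G + 2 * (Fintype.card ι * (1 / Fintype.card K)) := by
  classical
  have hK : (0 : ℝ) < Fintype.card K := by exact_mod_cast Fintype.card_pos
  have hG0 : 0 ≤ G := by
    obtain ⟨k⟩ := ‹Nonempty K›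
    exact (uniformAvg_nonneg fun _ => hf0 _).trans (hG fun _ => k)
  -- With so few keys the right-hand side is at least 1. Otherwise at least half of all values of
  -- key `i` avoid the keys in use.
  rcases lt_or_ge (Fintype.card K) (2 * Fintype.card ι) with h | h
  · refine (uniformAvg_mono fun κ => hf1 _).trans ((uniformAvg_const_le zero_le_one).trans ?_)
    have : (1 : ℝ) ≤ 2 * (Fintype.card ι * (1 / Fintype.card K)) := by
      rw [← mul_assoc, mul_one_div, le_div_iff₀ hK]
      exact_mod_cast (by omega : 1 * Fintype.card K ≤ 2 * Fintype.card ι)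
    linarith
  have hsum : ∀ F : (ι → K) → ℝ, ∑ κ : ι ↪ K, F κ =
      ∑ κ : ι → K, if Function.Injective κ then F κ else 0 := by
    intro F
    rw [← Finset.sum_filter, ← Finset.sum_subtype_eq_sum_filter]
    simp only [Finset.subtype_univ]
    exact (Fintype.sum_equiv (Equiv.subtypeInjectiveEquivEmbedding ι K) _ _ fun κ => rfl).symm
  -- Redrawing key `i` while remembering the old value is reversible, so the tuples before and after
  -- have the same distribution, also when both are required to be injective.
  have hinv : Function.Involutive fun p : (ι → K) × K => (Function.update p.1 i p.2, p.1 i) := by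
    rintro ⟨κ, k⟩
    simp
  have hswap : ∑ κ : ι → K, ∑ k : K,
        (if Function.Injective κ ∧ Function.Injective (Function.update κ i k) then f κ else 0) =
      ∑ κ : ι → K, ∑ k : K,
        (if Function.Injective κ ∧ Function.Injective (Function.update κ i k)
          then f (Function.update κ i k) else 0) := by
    rw [← Fintype.sum_prod_type', ← Fintype.sum_prod_type']
    refine Fintype.sum_equiv hinv.toPerm _ _ fun p => ?_
    simp [and_comm]
  have hcount : ∀ κ : ι → K, Function.Injective κ → (Fintype.card K : ℝ) / 2 ≤
      ∑ k : K, if Function.Injective (Function.update κ i k) then 1 else 0 := by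
    intro κ hκ
    rw [Finset.sum_boole]
    have h1 : (Finset.univ \ Finset.univ.image κ) ⊆
        Finset.univ.filter fun k => Function.Injective (Function.update κ i k) := by
      intro k hk
      have hk' : ∀ j, κ j ≠ k := by simpa using hk
      rw [Finset.mem_filter]
      refine ⟨Finset.mem_univ _, fun a b hab => ?_⟩
      by_cases ha : a = i <;> by_cases hb : b = i
      · rw [ha, hb]
      · subst ha
        rw [Function.update_self, Function.update_of_ne hb] at hab
        exact absurd hab.symm (hk' b)
      · subst hb
        rw [Function.update_self, Function.update_of_ne ha] at hab
        exact absurd hab (hk' a)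
      · rw [Function.update_of_ne ha, Function.update_of_ne hb] at hab
        exact hκ hab
    have h2 := Finset.card_le_card h1
    have h3 := Finset.le_card_sdiff (Finset.univ.image κ) (Finset.univ : Finset K)
    have h4 : (Finset.univ.image κ).card ≤ Fintype.card ι := Finset.card_image_le
    rw [Finset.card_univ] at h3
    have h5 : Fintype.card K ≤
      2 * (Finset.univ.filter fun k => Function.Injective (Function.update κ i k)).card := by omega
    have h6 : (Fintype.card K : ℝ) ≤
      2 * ((Finset.univ.filter fun k => Function.Injective (Function.update κ i k)).card : ℝ) := by
      exact_mod_cast h5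
    linarith
  have hmain : ∑ κ : ι ↪ K, f κ * (Fintype.card K / 2) ≤ ∑ κ : ι ↪ K, Fintype.card K * G := by
    rw [hsum fun κ => f κ * (Fintype.card K / 2), hsum fun _ => Fintype.card K * G]
    -- Each injective tuple has at least $|K|/2$ injective redrawings; the exchange moves `f` to the
    -- redrawn tuple; and dropping injectivity there leaves a free average over key `i`, bounded by
    -- `G`.
    calc ∑ κ : ι → K, (if Function.Injective κ then f κ * (Fintype.card K / 2) else 0)
        ≤ ∑ κ : ι → K, ∑ k : K, (if Function.Injective κ ∧
            Function.Injective (Function.update κ i k) then f κ else 0) := by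
          refine Finset.sum_le_sum fun κ _ => ?_
          by_cases hκ : Function.Injective κ
          · simp only [hκ, if_true, true_and]
            refine (mul_le_mul_of_nonneg_left (hcount κ hκ) (hf0 κ)).trans_eq ?_
            rw [Finset.mul_sum]
            simp only [mul_ite, mul_one, mul_zero]
          · simp [hκ]
      _ = _ := hswap
      _ ≤ _ := by
          refine Finset.sum_le_sum fun κ _ => ?_
          by_cases hκ : Function.Injective κ
          · simp only [hκ, if_true, true_and]
            have h1 := hG κ
            rw [uniformAvg, div_le_iff₀ hK] at h1
            rw [mul_comm]
            refine le_trans (Finset.sum_le_sum fun k _ => ?_) h1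
            split_ifs
            · exact le_rfl
            · exact hf0 _
          · simp [hκ]
  have h1 : uniformAvg (fun κ : ι ↪ K => f κ * (Fintype.card K / 2)) ≤ Fintype.card K * G :=
    (div_le_div_of_nonneg_right hmain (Nat.cast_nonneg _)).trans
      (uniformAvg_const_le (by positivity))
  simp only [mul_comm (f _), uniformAvg_mul_left] at h1
  have h2 : uniformAvg (fun κ : ι ↪ K => f κ) ≤ 2 * G := by
    have : (Fintype.card K : ℝ) * uniformAvg (fun κ : ι ↪ K => f κ) ≤ Fintype.card K * (2 * G) := by
      linarith
    exact le_of_mul_le_mul_left this hK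
  have h3 : (0 : ℝ) ≤ 2 * (Fintype.card ι * (1 / Fintype.card K)) := by positivity
  linarith

end Keys

/-! ## Security -/

section Security

variable {n : ℕ → ℕ}

/-- The encoding of the key is written by NOT gates, so a distinguisher with a hardwired key can
produce the challenge from $|0\ldots0\rangle$. -/
theorem IsPRS.exists_prepares {K' : ℕ → Type*} [∀ s, Fintype (K' s)]
    {φ : ∀ s, K' s → QVec (Fin (n s))} (hφ : IsPRS n φ) (hn : PolyBounded n) :
    ∃ b a L : ℕ → ℕ, PolyBounded (fun s => b s + a s) ∧ PolyBounded L ∧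
      ∀ s k, ∃ P : Circuit ((Fin (b s) ⊕ Fin (a s)) ⊕ Fin (n s)),
        P.length ≤ L s ∧ Prepares P (φ s k) := by
  obtain ⟨b, a, enc, C, hpoly, hC⟩ := hφ.efficient
  refine ⟨b, a, fun s => b s + a s + n s + (C s).length, hpoly.mono fun s => by omega,
    (hpoly.add hn).mono fun s => by omega, fun s k => ?_⟩
  obtain ⟨g, hg⟩ := hC s k
  obtain ⟨P, hPl, hP⟩ := exists_run_eq_basisState
    (Sum.elim (Sum.elim (enc s k) fun _ : Fin (a s) => false) fun _ : Fin (n s) => false)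
  refine ⟨P ++ C s, ?_, g, ?_⟩
  · simp only [Fintype.card_sum, Fintype.card_fin] at hPl
    simp only [List.length_append]
    omega
  · rw [Circuit.run_append, hP, ← tensor_basisState, ← tensor_basisState]
    exact hg

/-- The states of a pseudorandom family overlap negligibly, on average over one of them. -/
theorem IsPRS.exists_overlap_bound {K' : ℕ → Type*} [∀ s, Fintype (K' s)] [∀ s, Nonempty (K' s)]
    {φ : ∀ s, K' s → QVec (Fin (n s))} (hφ : IsPRS n φ) (hn : PolyBounded n)
    (hdim : Negligible fun s => (1 / 2 : ℝ) ^ n s) :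
    ∃ μ : ℕ → ℝ, Negligible μ ∧
      ∀ s k, uniformAvg (fun l => ‖ip (φ s k) (φ s l)‖ ^ 2) ≤ μ s := by
  obtain ⟨b, a, L, hba, hL, hP⟩ := hφ.exists_prepares hn
  choose P hPl hP using hP
  choose D hD hprob using fun s k => exists_overlap_distinguisher (hP s k) (hφ.unit s k)
  obtain ⟨ε, hε, hεD⟩ := exists_negligible_bound
    (size := fun s (D : StateDistinguisher (n s) 1) => D.size)
    (adv := fun s D => uniformAvg (fun k => D.prob (φ s k)) - haarStateAvg (n s) D.prob)
    (hφ.pseudorandom (fun _ => 1) (PolyBounded.const 1)) D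
    (L := fun s => (b s + a s) + 2 * n s + L s + 3)
    (((hba.add ((PolyBounded.const 2).mul hn)).add hL).add (PolyBounded.const 3))
    fun s k => by
      rw [hD]
      simp only [Fintype.card_sum, Fintype.card_fin]
      have := hPl s k
      omega
  -- The Haar value of the overlap plus the advantage, doubled because the swap test fails with
  -- probability $(1-\text{overlap})/2$.
  refine ⟨fun s => (1 / 2 : ℝ) ^ n s + 2 * ε s, hdim.add (hε.const_mul 2), fun s k => ?_⟩
  have h := hεD s k
  have h1 : uniformAvg (fun l => (D s k).prob (φ s l)) =
      (1 - uniformAvg (fun l => ‖ip (φ s k) (φ s l)‖ ^ 2)) / 2 := by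
    simp only [fun l => hprob s k (φ s l) (hφ.unit s l)]
    have : ∀ x : ℝ, (1 - x) / 2 = 1 / 2 - 1 / 2 * x := fun x => by ring
    simp only [this]
    rw [uniformAvg_sub, uniformAvg_const, uniformAvg_mul_left]
  have h2 : haarStateAvg (n s) (D s k).prob = (1 - (1 / 2) ^ n s) / 2 := by
    rw [← haarStateAvg_overlap (hφ.unit s k), haarStateAvg, haarStateAvg]
    have hc : Continuous fun V : QUnitary (Fin (n s)) =>
        ‖ip (φ s k) (applyU V (zeroState (Fin (n s))))‖ ^ 2 := by
      have : ∀ x, Continuous fun V : QUnitary (Fin (n s)) => applyU V (zeroState _) x :=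
        fun x => (continuous_apply x).comp (continuous_applyU _)
      exact (continuous_finsetSum _ fun x _ => continuous_const.mul (this x)).norm.pow 2
    have h3 : ∀ V : QUnitary (Fin (n s)), (D s k).prob (applyU V (zeroState _)) =
        (1 - ‖ip (φ s k) (applyU V (zeroState (Fin (n s))))‖ ^ 2) / 2 := fun V =>
      hprob s k _ (by rw [normSq_applyU, normSq_zeroState])
    simp only [h3]
    rw [integral_div, integral_sub (integrable_const _) (integrable_haarUnitary hc)]
    simp
  rw [h1, h2] at h
  have := (abs_le.mp h).1
  linarith

/-- A correct response is about as likely for a pseudorandom device as for a Haar random one. -/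
theorem IsPRU.exists_hit_bound {K : ℕ → Type*} [∀ s, Fintype (K s)] [∀ s, Nonempty (K s)]
    {U : ∀ s, K s → QUnitary (Fin (n s))} (hU : IsPRU n U)
    {K' : ℕ → Type*} [∀ s, Fintype (K' s)] {φ : ∀ s, K' s → QVec (Fin (n s))} (hφ : IsPRS n φ)
    (hn : PolyBounded n) {T : ℕ → Type} [∀ s, Fintype (T s)] [∀ s, DecidableEq (T s)]
    (hT : PolyBounded fun s => Fintype.card (T s)) (A : ∀ s, Adversary (n s) (T s))
    (hA : PolyBounded fun s => (A s).size) :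
    ∃ ε : ℕ → ℝ, Negligible ε ∧ ∀ s (t : T s) (κ : T s → K' s),
      uniformAvg (fun k => (A s).hit t (U s k) fun t' => φ s (κ t')) ≤
        ∫ V, (A s).hit t V (fun t' => φ s (κ t')) ∂(haarUnitary (n s)) + ε s := by
  obtain ⟨b, a, L, hba, hL, hP⟩ := hφ.exists_prepares hn
  choose D hD hprob using fun s (p : T s × (T s → K' s)) =>
    exists_hit_distinguisher (A s) p.1 (c := fun t' => φ s (p.2 t'))
      (fun t' => hφ.unit s (p.2 t')) fun t' => hP s (p.2 t')
  obtain ⟨ε, hε, hεD⟩ := exists_negligible_bound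
    (size := fun s (D : UnitaryDistinguisher (n s)) => D.size)
    (adv := fun s D => uniformAvg (fun k => D.prob (U s k)) - ∫ V, D.prob V ∂(haarUnitary (n s)))
    hU.pseudorandom
    -- The challenge keys are hardwired, which makes the bound uniform in them. The additional index
    -- carries a trivial distinguisher, so that the index set is nonempty even without challenges.
    (I := fun s => Option (T s × (T s → K' s)))
    (fun s o => o.elim ⟨1, [], 0⟩ (D s))
    (L := fun s => (A s).size + (Fintype.card (T s) + 1) * ((b s + a s) + n s + L s) + n s + 4)
    (((hA.add ((hT.add (PolyBounded.const 1)).mul ((hba.add hn).add hL))).add hn).add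
      (PolyBounded.const 4))
    fun s o => by
      cases o with
      | none => simp only [Option.elim, UnitaryDistinguisher.size, List.length_nil]; omega
      | some p => simpa using hD s p
  refine ⟨fun s => 2 * ε s, hε.const_mul 2, fun s t κ => ?_⟩
  have h := hεD s (some (t, κ))
  simp only [Option.elim] at h
  have hlin : ∀ x : ℝ, (1 - x) / 2 = 1 / 2 - 1 / 2 * x := fun x => by ring
  have h1 : uniformAvg (fun k => (D s (t, κ)).prob (U s k)) =
      (1 - uniformAvg (fun k => (A s).hit t (U s k) fun t' => φ s (κ t'))) / 2 := by
    simp only [hprob, hlin]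
    rw [uniformAvg_sub, uniformAvg_const, uniformAvg_mul_left]
  have h2 : ∫ V, (D s (t, κ)).prob V ∂(haarUnitary (n s)) =
      (1 - ∫ V, (A s).hit t V (fun t' => φ s (κ t')) ∂(haarUnitary (n s))) / 2 := by
    simp only [hprob]
    rw [integral_div, integral_sub (integrable_const _)
      (integrable_haarUnitary ((A s).continuous_hit _ _))]
    simp
  rw [h1, h2] at h
  have := (abs_le.mp h).1
  linarith

/-- The pairs of equal keys alone contribute this much. A small mean overlap therefore forces a
large key set, and drawing different keys costs little. -/
theorem one_div_card_le_meanOverlap {κ K : Type*} [Fintype κ] [DecidableEq κ] [Fintype K]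
    [Nonempty K] {φ : K → QVec κ} (hφ : ∀ k, normSq (φ k) = 1) :
    1 / (Fintype.card K : ℝ) ≤ meanOverlap φ := by
  rw [← uniformAvg_const (K := K) (1 / (Fintype.card K : ℝ))]
  refine uniformAvg_mono fun k => div_le_div_of_nonneg_right ?_ (Nat.cast_nonneg _)
  have h : ‖ip (φ k) (φ k)‖ ^ 2 = 1 := by rw [ip_self, hφ]; simp
  rw [← h]
  exact Finset.single_le_sum (f := fun l => ‖ip (φ k) (φ l)‖ ^ 2) (fun _ _ => by positivity)
    (Finset.mem_univ k)

/-- Every polynomial-size adversary passes the verification with at most the probability of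
guessing, up to a negligible term. -/
theorem exists_acceptProb_bound (hn : PolyBounded n)
    (hdim : Negligible fun s => (1 / 2 : ℝ) ^ n s)
    {K : ℕ → Type*} [∀ s, Fintype (K s)] [∀ s, Nonempty (K s)]
    {U : ∀ s, K s → QUnitary (Fin (n s))} (hU : IsPRU n U)
    {K' : ℕ → Type*} [∀ s, Fintype (K' s)] [∀ s, Nonempty (K' s)]
    {φ : ∀ s, K' s → QVec (Fin (n s))} (hφ : IsPRS n φ)
    {N : ℕ → ℕ} (hN : PolyBounded N) (M : ℕ → ℕ)
    [∀ s, Fintype (Fin (N s) ↪ K' s)]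
    {T : ℕ → Type} [∀ s, Fintype (T s)] [∀ s, DecidableEq (T s)]
    (hT : PolyBounded fun s => Fintype.card (T s)) (idx : ∀ s, T s → Fin (N s))
    (A : ∀ s, Adversary (n s) (T s)) (hA : PolyBounded fun s => (A s).size) :
    ∃ ε : ℕ → ℝ, Negligible ε ∧ ∀ s,
      (uniformAvg fun k => uniformAvg fun κ : Fin (N s) ↪ K' s =>
        (A s).acceptProb (M s) (U s k) fun t => φ s (κ (idx s t))) ≤
      1 / ((M s : ℝ) + 1) ^ Fintype.card (T s) + ε s := by
  obtain ⟨μ, hμ, hμφ⟩ := hφ.exists_overlap_bound hn hdim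
  obtain ⟨ε, hε, hεA⟩ := hU.exists_hit_bound hφ hn hT A hA
  have hmean : ∀ s, meanOverlap (φ s) ≤ μ s := fun s =>
    (uniformAvg_mono (hμφ s)).trans_eq (uniformAvg_const _)
  set G : ℕ → ℝ := fun s => 2 * (1 / 2) ^ n s +
    16 * (((A s).size * (A s).size : ℕ) * (√(μ s) + (1 / 2) ^ n s)) + ε s with hG
  have hGneg : Negligible G :=
    ((hdim.const_mul 2).add (((hμ.sqrt.add hdim).poly_mul (hA.mul hA)).const_mul 16)).add hε
  -- The maximum with 0 supplies the nonnegative bound that the acceptance estimate requires; it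
  -- stays negligible because it is at most the absolute value.
  refine ⟨fun s => max 0 (2 * G s + 2 * (N s * μ s)), ?_, fun s => ?_⟩
  · refine ((hGneg.const_mul 2).add ((hμ.poly_mul hN).const_mul 2)).mono fun s => ?_
    rw [abs_of_nonneg (le_max_left _ _)]
    exact max_le (abs_nonneg _) (le_abs_self _)
  · rw [← uniformAvg_prod]
    refine (A s).uniformAvg_acceptProb_le (M s) (fun p : K s × (Fin (N s) ↪ K' s) => U s p.1)
      (c := fun p t => φ s (p.2 (idx s t))) (fun _ _ => hφ.unit s _) (le_max_left _ _) fun t => ?_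
    refine le_trans ?_ (le_max_right _ _)
    rw [uniformAvg_prod fun k (κ : Fin (N s) ↪ K' s) =>
      (A s).hit t (U s k) fun t' => φ s (κ (idx s t')), uniformAvg_comm]
    have hunit : ∀ κ : Fin (N s) → K' s, ∀ t', normSq (φ s (κ (idx s t'))) = 1 :=
      fun κ t' => hφ.unit s _
    -- The key behind challenge `t` is redrawn with the others held fixed. All challenges with the
    -- same index change along with it, as the `M` repetitions in SWAP verification do.
    have hG' : ∀ κ : Fin (N s) → K' s, uniformAvg (fun l => uniformAvg fun k =>
        (A s).hit t (U s k) fun t' => φ s (Function.update κ (idx s t) l (idx s t'))) ≤ G s := by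
      intro κ
      refine (uniformAvg_mono fun l =>
        hεA s t fun t' => Function.update κ (idx s t) l (idx s t')).trans ?_
      rw [uniformAvg_add, uniformAvg_const]
      refine add_le_add ?_ le_rfl
      refine ((A s).uniformAvg_integral_hit_le t
        (fun l t' => φ s (Function.update κ (idx s t) l (idx s t')))
        fun l t' => hφ.unit s _).trans ?_
      simp only [Function.update_self]
      have h1 : ((A s).learn.length : ℝ) ≤ (A s).size := by
        rw [Adversary.size]; push_cast; linarith [Nat.cast_nonneg (α := ℝ) (A s).work,
          Nat.cast_nonneg (α := ℝ) (A s).respond.length]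
      have h2 : √(meanOverlap fun l => φ s l) ≤ √(μ s) := Real.sqrt_le_sqrt (hmean s)
      have h3 : ((A s).learn.length : ℝ) ^ 2 ≤ ((A s).size * (A s).size : ℕ) := by
        push_cast
        nlinarith [Nat.cast_nonneg (α := ℝ) (A s).learn.length]
      rw [mul_assoc 16]
      gcongr
    refine (uniformAvg_embedding_le (f := fun κ : Fin (N s) → K' s => uniformAvg fun k =>
      (A s).hit t (U s k) fun t' => φ s (κ (idx s t')))
      (fun κ => uniformAvg_nonneg fun _ => (A s).hit_nonneg _ _ _)
      (fun κ => (uniformAvg_mono fun _ => (A s).hit_le_one _ _ (hunit κ)).trans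
        (uniformAvg_const_le zero_le_one)) (idx s t) hG').trans ?_
    have h4 := (one_div_card_le_meanOverlap (hφ.unit s)).trans (hmean s)
    rw [Fintype.card_fin]
    gcongr

end Security

end QIdent

/-- SWAP verification is the case of $NM$ tests against one copy each, GSWAP verification that of
$N$ tests against $M$ copies. If the reciprocal of the guessing probability is polynomially bounded,
the negligible term is eventually below the guessing probability, hence the factor 2. -/
theorem mainTheorem6 (n : ℕ → ℕ) (hn : QIdent.PolyBounded n)
    (hdim : QIdent.Negligible fun s => (1 / 2 : ℝ) ^ n s)
    {K : ℕ → Type*} [∀ s, Fintype (K s)] [∀ s, Nonempty (K s)]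
    (U : ∀ s, K s → QIdent.QUnitary (Fin (n s))) (hU : QIdent.IsPRU n U)
    {K' : ℕ → Type*} [∀ s, Fintype (K' s)] [∀ s, Nonempty (K' s)]
    (φ : ∀ s, K' s → QIdent.QVec (Fin (n s))) (hφ : QIdent.IsPRS n φ)
    (N M : ℕ → ℕ) (hN : QIdent.PolyBounded N) (hM : QIdent.PolyBounded M) :
    (∀ A : ∀ s, QIdent.Adversary (n s) (Fin (N s) × Fin (M s)),
      QIdent.PolyBounded (fun s => (A s).size) →
      (∃ ε : ℕ → ℝ, QIdent.Negligible ε ∧ ∀ s,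
        QIdent.swapPass (N s) (M s) (U s) (φ s) (A s) ≤ 1 / 2 ^ (N s * M s) + ε s) ∧
      (QIdent.PolyBounded (fun s => 2 ^ (N s * M s)) → ∀ᶠ s in Filter.atTop,
        QIdent.swapPass (N s) (M s) (U s) (φ s) (A s) ≤ 2 * (1 / 2 ^ (N s * M s)))) ∧
    (∀ A : ∀ s, QIdent.Adversary (n s) (Fin (N s)),
      QIdent.PolyBounded (fun s => (A s).size) →
      (∃ ε : ℕ → ℝ, QIdent.Negligible ε ∧ ∀ s,
        QIdent.gswapPass (N s) (M s) (U s) (φ s) (A s) ≤ 1 / ((M s : ℝ) + 1) ^ N s + ε s) ∧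
      (QIdent.PolyBounded (fun s => (M s + 1) ^ N s) → ∀ᶠ s in Filter.atTop,
        QIdent.gswapPass (N s) (M s) (U s) (φ s) (A s) ≤ 2 * (1 / ((M s : ℝ) + 1) ^ N s))) := by
  have tail : ∀ {p ε : ℕ → ℝ} {f : ℕ → ℕ}, QIdent.Negligible ε → (∀ s, 0 < f s) →
      (∀ s, p s ≤ 1 / (f s : ℝ) + ε s) → QIdent.PolyBounded f →
      ∀ᶠ s in Filter.atTop, p s ≤ 2 * (1 / (f s : ℝ)) := by
    intro p ε f hε hf hp hpoly
    filter_upwards [hε.eventually_le_one_div hpoly hf] with s hs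
    linarith [hp s]
  refine ⟨fun A hA => ?_, fun A hA => ?_⟩
  · classical
    obtain ⟨ε, hε, h⟩ := QIdent.exists_acceptProb_bound hn hdim hU hφ hN (fun _ => 1)
      (T := fun s => Fin (N s) × Fin (M s))
      (by simpa using hN.mul hM) (fun s t => t.1) A hA
    have h' : ∀ s, QIdent.swapPass (N s) (M s) (U s) (φ s) (A s) ≤
        1 / 2 ^ (N s * M s) + ε s := by
      intro s
      have := h s
      simp only [Fintype.card_prod, Fintype.card_fin, Nat.cast_one, one_add_one_eq_two] at this
      unfold QIdent.swapPass
      convert this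
    refine ⟨⟨ε, hε, h'⟩, fun hpoly => ?_⟩
    simpa using tail (f := fun s => 2 ^ (N s * M s)) hε (fun s => by positivity)
      (by simpa using h') hpoly
  · classical
    obtain ⟨ε, hε, h⟩ := QIdent.exists_acceptProb_bound hn hdim hU hφ hN M
      (T := fun s => Fin (N s)) (by simpa using hN) (fun s t => t) A hA
    have h' : ∀ s, QIdent.gswapPass (N s) (M s) (U s) (φ s) (A s) ≤
        1 / ((M s : ℝ) + 1) ^ N s + ε s := by
      intro s
      have := h s
      simp only [Fintype.card_fin] at this
      unfold QIdent.gswapPass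
      convert this
    refine ⟨⟨ε, hε, h'⟩, fun hpoly => ?_⟩
    simpa using tail (f := fun s => (M s + 1) ^ N s) hε (fun s => by positivity)
      (by simpa using h') hpoly
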